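/- Let $\alpha,\beta:\mathbb C^4\to\mathbb C^4$ be $\alpha(z)=(iz_1,iz_2,iz_3,iz_4)$ and $\beta(z)=(\bar z_2,-\bar z_1,\bar z_4,-\bar z_3)$, and let $G=\langle\alpha,\beta\rangle$, a group of order $8$ acting isometrically on $\mathbb R^8=\mathbb C^4$, where $z_1=x_1+ix_2,\ \dots,\ z_4=x_7+ix_8$. Write $r$ for the radius function on $\mathbb R^8/G$ and $B_s$, $\overline B_s$ for the open and closed balls of radius $s$ about $0$ in $\mathbb R^8/G$. *The two resolutions.* Let $Y_1$ be the blow-up of $\mathbb C^4/\langle\alpha\rangle$ at $0$ (its crepant resolution), let $X_1=Y_1/\langle\beta\rangle$, where $\beta$ acts by its free lift to $Y_1$, and let $\pi_1:X_1\to\mathbb R^8/G$ be the projection. Let $X_2$, $\pi_2:X_2\to\mathbb R^8/G$ be obtained in the same way from the complex coordinates $(w_1,w_2,w_3,w_4)=(-x_1+ix_3,\,x_2+ix_4,\,-x_5+ix_7,\,x_6+ix_8)$ on $\mathbb R^8$, in which $\beta$ is multiplication by $i$ and $\alpha$ acts by $w\mapsto(\bar w_2,-\bar w_1,\bar w_4,-\bar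 w_3)$: that is, $X_2=Y_2/\langle\alpha\rangle$, where $Y_2$ is the crepant resolution of $\mathbb C^4/\langle\beta\rangle$. For $t\in(0,1]$ put $\pi_n^t=t\,\pi_n$. *The orbifold.* Let $Y$ be a compact (Hausdorff) complex orbifold of complex dimension $4$ whose singular set consists of $k\ge1$ distinct points $p_1,\dots,p_k$, each modelled on $\mathbb C^4/\langle\alpha\rangle$, such that $Y\setminus\{p_1,\dots,p_k\}$ is simply connected. Let $\sigma:Y\to Y$ be an antiholomorphic involution whose fixed point set is exactly $\{p_1,\dots,p_k\}$, and put $Z=Y/\langle\sigma\rangle$. Let $\zeta>0$, and for each $j$ let $c_j$ be a smooth orbifold chart of $Y$, with group $\langle\alpha\rangle$, defined on the ball of radius $2\zeta$ in $\mathbb C^4$, with $c_j(0)=p_j$, which induces a homeomorphism $\psi_j$ from $B_{2\zeta}$ onto an open subset $U_j$ of $Z$; suppose that $U_i\cap U_j=\emptyset$ for $i\neq j$. (For example, if $g$ is a $\sigma$-invariant Calabi--Yau metric on $Y$ and $\zeta$ is small, $c_j$ may be the exponential map of $g$ at $p_j$, composed with an identification of $\mathbb C^4/\langle\alpha\rangle$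 with $T_{p_j}Y$ that takes $\beta$ to $\mathrm d\sigma$.) *The desingularization.* Choose $n_j\in\{1,2\}$ for $j=1,\dots,k$ and $t\in(0,1]$. Put $$M_0^t=Z\setminus\bigcup_{j=1}^k\psi_j\bigl(\overline B_{t^{4/5}\zeta}\bigr),\qquad M_j^t=(\pi_{n_j}^t)^{-1}\bigl(B_{2t^{4/5}\zeta}\bigr)\subset X_{n_j}\quad(1\le j\le k),$$ and let $M^t$ be the quotient of the disjoint union $\coprod_{j=0}^kM_j^t$ in which $x\in M_j^t$ is identified with $y\in M_0^t$ whenever $\psi_j(\pi^t_{n_j}(x))=y$, $1\le j\le k$. Then: if $n_j=1$ for all $j=1,\dots,k$, then $M^t$ is path connected and $\pi_1(M^t)\cong\mathbb Z_2$. Otherwise, $M^t$ is simply connected. -/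

import Mathlib

open Set Topology Metric
open scoped ContDiff LinearAlgebra.Projectivization

noncomputable section

namespace Spin7Resolution

/-! ### The linear model -/

/-- `ℂ⁴` with its Hermitian norm. As a real normed space it is `ℝ⁸`, where
`(z₁, z₂, z₃, z₄) = (x₁ + i x₂, x₃ + i x₄, x₅ + i x₆, x₇ + i x₈)`. -/
abbrev C4 : Type := EuclideanSpace ℂ (Fin 4)

/-- Coordinatewise complex conjugation on `ℂ⁴`. -/
def conj4 (z : C4) : C4 := WithLp.toLp 2 fun i => starRingEnd ℂ (z i)

/-- `α (z₁, z₂, z₃, z₄) = (i z₁, i z₂, i z₃, i z₄)`, as a complex linear map. -/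
def alphaC : C4 ≃ₗ[ℂ] C4 := LinearEquiv.smulOfNeZero ℂ C4 Complex.I Complex.I_ne_zero

/-- `α (z₁, z₂, z₃, z₄) = (i z₁, i z₂, i z₃, i z₄)`, as an isometry of `ℝ⁸ = ℂ⁴`. -/
def alpha : C4 ≃ₗᵢ[ℝ] C4 where
  toLinearEquiv := alphaC.restrictScalars ℝ
  norm_map' z := by
    change ‖Complex.I • z‖ = ‖z‖
    simp [norm_smul]

/-- `β (z₁, z₂, z₃, z₄) = (conj z₂, - conj z₁, conj z₄, - conj z₃)`, as an isometry of
`ℝ⁸ = ℂ⁴`. -/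
def beta : C4 ≃ₗᵢ[ℝ] C4 where
  toFun z := !₂[starRingEnd ℂ (z 1), -starRingEnd ℂ (z 0),
    starRingEnd ℂ (z 3), -starRingEnd ℂ (z 2)]
  invFun z := !₂[-starRingEnd ℂ (z 1), starRingEnd ℂ (z 0),
    -starRingEnd ℂ (z 3), starRingEnd ℂ (z 2)]
  map_add' z w := by
    ext i; fin_cases i <;> simp [add_comm]
  map_smul' r z := by
    ext i; fin_cases i <;> simp
  left_inv z := by
    ext i; fin_cases i <;> simp
  right_inv z := by
    ext i; fin_cases i <;> simp
  norm_map' z := by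
    simp only [EuclideanSpace.norm_eq, Fin.sum_univ_four]
    congr 1
    simp
    ring

/-- The finite group `G = ⟨α, β⟩` of isometries of `ℝ⁸`. -/
def G : Subgroup (C4 ≃ₗᵢ[ℝ] C4) := Subgroup.closure {alpha, beta}

/-- The second system of complex coordinates on `ℝ⁸`,
`(w₁, w₂, w₃, w₄) = (-x₁ + i x₃, x₂ + i x₄, -x₅ + i x₇, x₆ + i x₈)`.
In these coordinates `β` is multiplication by `i` and `α` acts in the way in which `β` acts in
the coordinates `z`. -/
def coordW : C4 ≃ₗᵢ[ℝ] C4 where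
  toFun z := !₂[⟨-(z 0).re, (z 1).re⟩, ⟨(z 0).im, (z 1).im⟩,
    ⟨-(z 2).re, (z 3).re⟩, ⟨(z 2).im, (z 3).im⟩]
  invFun w := !₂[⟨-(w 0).re, (w 1).re⟩, ⟨(w 0).im, (w 1).im⟩,
    ⟨-(w 2).re, (w 3).re⟩, ⟨(w 2).im, (w 3).im⟩]
  map_add' z w := by
    ext i; fin_cases i <;> simp [Complex.ext_iff, add_comm]
  map_smul' r z := by
    ext i; fin_cases i <;> simp [Complex.ext_iff]
  left_inv z := by
    ext i; fin_cases i <;> simp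
  right_inv z := by
    ext i; fin_cases i <;> simp
  norm_map' z := by
    simp only [EuclideanSpace.norm_eq, Fin.sum_univ_four]
    congr 1
    simp [Complex.sq_norm, Complex.normSq_apply]
    ring

/-! ### The cone `ℝ⁸ / G` -/

/-- Two points of `ℝ⁸` are equivalent if they lie in the same `G`-orbit. -/
def coneSetoid : Setoid C4 where
  r v w := ∃ g ∈ G, g v = w
  iseqv :=
    { refl := fun v => ⟨1, G.one_mem, rfl⟩
      symm := by
        rintro v w ⟨g, hg, rfl⟩
        exact ⟨g⁻¹, G.inv_mem hg, g.symm_apply_apply v⟩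
      trans := by
        rintro u v w ⟨g, hg, rfl⟩ ⟨h, hh, rfl⟩
        exact ⟨h * g, G.mul_mem hh hg, rfl⟩ }

/-- The orbit space `ℝ⁸ / G`, with the quotient topology. -/
def Cone : Type := Quotient coneSetoid

instance : TopologicalSpace Cone := inferInstanceAs (TopologicalSpace (Quotient coneSetoid))

/-- The projection `ℝ⁸ → ℝ⁸ / G`. -/
def Cone.mk (v : C4) : Cone := Quotient.mk coneSetoid v

/-- The radius function `r` on `ℝ⁸ / G`. -/
def Cone.radius : Cone → ℝ :=
  Quotient.lift (fun v : C4 => ‖v‖) (by rintro v w ⟨g, -, rfl⟩; exact (g.norm_map v).symm)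

/-- Multiplication by a real number `t` on `ℝ⁸ / G`. -/
def Cone.scale (t : ℝ) : Cone → Cone :=
  Quotient.map (fun v : C4 => t • v) (by
    rintro v w ⟨g, hg, rfl⟩
    exact ⟨g, hg, g.map_smul t v⟩)

/-! ### The two resolutions `X₁`, `X₂` of `ℝ⁸ / G` -/

/-- The quotient topology on `ℂℙ³`. -/
instance : TopologicalSpace (ℙ ℂ C4) :=
  TopologicalSpace.coinduced
    (fun v : {v : C4 // v ≠ 0} => Projectivization.mk ℂ v.1 v.2) inferInstance

/-- The two ways of resolving `ℝ⁸ / G`. -/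
inductive Kind : Type
  /-- resolve using `X₁` -/
  | X1
  /-- resolve using `X₂` -/
  | X2

/-- The complex coordinates on `ℝ⁸` used to construct `X₁` (the coordinates `z`) and `X₂`
(the coordinates `w`). -/
def Kind.coord : Kind → (C4 ≃ₗᵢ[ℝ] C4)
  | .X1 => LinearIsometryEquiv.refl ℝ C4
  | .X2 => coordW

/-- The blow-up of `ℝ⁸` at `0`, for the complex structure on `ℝ⁸` given by the coordinates
`κ.coord`: pairs of a point `v` and a complex line `ℓ` through `0` that contains it. -/
def BlowUp (κ : Kind) : Type := {q : C4 × ℙ ℂ C4 // κ.coord q.1 ∈ q.2.submodule}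

instance (κ : Kind) : TopologicalSpace (BlowUp κ) :=
  inferInstanceAs (TopologicalSpace {q : C4 × ℙ ℂ C4 // κ.coord q.1 ∈ q.2.submodule})

/-- The orbit equivalence relation of the action `g (v, ℓ) = (g v, g ℓ)` of `G` on the blow-up.
Here a line is written in the coordinates `κ.coord`, so `g` acts on lines through the
conjugate of `g` by `κ.coord`. -/
def blowUpSetoid (κ : Kind) : Setoid (BlowUp κ) where
  r a b := ∃ g ∈ G, g a.1.1 = b.1.1 ∧
    (fun z => κ.coord (g (κ.coord.symm z))) '' (a.1.2.submodule : Set C4) = b.1.2.submodule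
  iseqv :=
    { refl := fun a => ⟨1, G.one_mem, rfl, by simp⟩
      symm := by
        rintro a b ⟨g, hg, h1, h2⟩
        refine ⟨g⁻¹, G.inv_mem hg, ?_, ?_⟩
        · rw [← h1]; exact g.symm_apply_apply _
        · rw [← h2, Set.image_image]
          have : ∀ z, g⁻¹ (g z) = z := g.symm_apply_apply
          simp [this]
      trans := by
        rintro a b c ⟨g, hg, h1, h2⟩ ⟨h, hh, h3, h4⟩
        refine ⟨h * g, G.mul_mem hh hg, ?_, ?_⟩
        · rw [← h3, ← h1]; rfl
        · rw [← h4, ← h2, Set.image_image]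
          simp }

/-- The resolution `X₁` or `X₂` of `ℝ⁸ / G`.

For `X₁`: dividing the blow-up of `ℂ⁴` at `0` by `⟨α⟩` (which acts trivially on lines) gives
`Y₁ = {([v], ℓ) : v ∈ ℓ} ⊆ ℂ⁴ / ⟨α⟩ × ℂℙ³`, the total space of `𝒪(-4)`, which is the blow-up of
`ℂ⁴ / ⟨α⟩` at `0`, its crepant resolution. Dividing further by the free antiholomorphic
involution of `Y₁` induced by `β` gives `X₁ = Y₁ / ⟨β⟩`.

For `X₂` the same is done in the coordinates `w`, in which `α` and `β` change places:
`X₂ = Y₂ / ⟨α⟩`, where `Y₂` is the crepant resolution of `ℂ⁴ / ⟨β⟩`. -/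
def ALE (κ : Kind) : Type := Quotient (blowUpSetoid κ)

instance (κ : Kind) : TopologicalSpace (ALE κ) :=
  inferInstanceAs (TopologicalSpace (Quotient (blowUpSetoid κ)))

/-- The resolution map `π : X → ℝ⁸ / G`, `[(v, ℓ)] ↦ [v]`. -/
def ALE.proj {κ : Kind} : ALE κ → Cone :=
  Quotient.lift (fun a : BlowUp κ => Cone.mk a.1.1) (by
    rintro a b ⟨g, hg, h1, -⟩
    exact Quotient.sound ⟨g, hg, h1⟩)

/-- The rescaled resolution map `πᵗ = t π`. -/
def ALE.projScaled {κ : Kind} (t : ℝ) (x : ALE κ) : Cone := Cone.scale t x.proj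

/-! ### Complex orbifolds of dimension four -/

/-- An orbifold chart on `Y`: a finite group `Γ` of complex linear maps, a `Γ`-invariant open set
`dom ⊆ ℂ⁴`, and a map `dom → Y` which induces a homeomorphism from `dom / Γ` onto an open subset
of `Y`. (The values of `toFun` outside `dom` are irrelevant.) -/
structure OrbifoldChart (Y : Type*) [TopologicalSpace Y] where
  dom : Set C4
  isOpen_dom : IsOpen dom
  Γ : Subgroup (C4 ≃ₗ[ℂ] C4)
  finite_Γ : Finite Γ
  map_dom : ∀ g ∈ Γ, ∀ x ∈ dom, g x ∈ dom
  toFun : C4 → Y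
  continuousOn : ContinuousOn toFun dom
  isOpen_image : ∀ U ⊆ dom, IsOpen U → IsOpen (toFun '' U)
  eq_iff : ∀ x ∈ dom, ∀ y ∈ dom, toFun x = toFun y ↔ ∃ g ∈ Γ, g x = y

/-- `h` is holomorphic on `s`. -/
def Holomorphic (h : C4 → C4) (s : Set C4) : Prop := DifferentiableOn ℂ h s

/-- `h` is antiholomorphic on `s`. -/
def Antiholomorphic (h : C4 → C4) (s : Set C4) : Prop :=
  DifferentiableOn ℂ (fun z => conj4 (h z)) s

/-- `h` is smooth on `s`, as a map between open subsets of `ℝ⁸`. -/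
def RealSmooth (h : C4 → C4) (s : Set C4) : Prop := ContDiffOn ℝ ∞ h s

/-- In the charts `c`, `d`, the map `f : Y → Y` lifts locally to homeomorphisms between open
subsets of `ℂ⁴` that have, together with their inverses, the property `P`. -/
def LiftsTo {Y : Type*} [TopologicalSpace Y] (P : (C4 → C4) → Set C4 → Prop) (f : Y → Y)
    (c d : OrbifoldChart Y) : Prop :=
  ∀ x ∈ c.dom, ∀ y ∈ d.dom, f (c.toFun x) = d.toFun y →
    ∃ h : OpenPartialHomeomorph C4 C4,
      x ∈ h.source ∧ h x = y ∧ h.source ⊆ c.dom ∧ h.target ⊆ d.dom ∧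
      (∀ z ∈ h.source, d.toFun (h z) = f (c.toFun z)) ∧
      P h h.source ∧ P h.symm h.target

/-- The structure of a complex orbifold of complex dimension four on a topological space: an
atlas of orbifold charts with holomorphic transition maps. -/
structure ComplexOrbifold (Y : Type*) [TopologicalSpace Y] where
  atlas : Set (OrbifoldChart Y)
  covers : ∀ y : Y, ∃ c ∈ atlas, ∃ x ∈ c.dom, c.toFun x = y
  compatible : ∀ c ∈ atlas, ∀ d ∈ atlas, LiftsTo Holomorphic id c d

variable {Y : Type*} [TopologicalSpace Y]

/-- The singular set of a complex orbifold: the points with nontrivial local group. -/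
def ComplexOrbifold.singularSet (A : ComplexOrbifold Y) : Set Y :=
  {y | ∃ c ∈ A.atlas, ∃ x ∈ c.dom, c.toFun x = y ∧ ∃ g ∈ c.Γ, g ≠ 1 ∧ g x = x}

/-- Near `y` the complex orbifold is modelled on `ℂ⁴ / ⟨α⟩`: there is a holomorphically
compatible chart with group `⟨α⟩` that takes `0` to `y`. -/
def ComplexOrbifold.ModelledOnZ4 (A : ComplexOrbifold Y) (y : Y) : Prop :=
  ∃ c : OrbifoldChart Y, (∀ d ∈ A.atlas, LiftsTo Holomorphic id c d) ∧
    c.Γ = Subgroup.zpowers alphaC ∧ (0 : C4) ∈ c.dom ∧ c.toFun 0 = y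

/-- `σ` is an antiholomorphic involution of the complex orbifold, the singular points are exactly
the distinct points `p j`, each modelled on `ℂ⁴ / ⟨α⟩`, they are exactly the fixed points of `σ`,
and their complement is simply connected. -/
structure ComplexOrbifold.Admissible (A : ComplexOrbifold Y) (σ : Y → Y) {k : ℕ}
    (p : Fin k → Y) : Prop where
  involutive : Function.Involutive σ
  continuous : Continuous σ
  antiholomorphic : ∀ c ∈ A.atlas, ∀ d ∈ A.atlas, LiftsTo Antiholomorphic σ c d
  injective : Function.Injective p
  singularSet_eq : A.singularSet = range p
  modelled : ∀ j, A.ModelledOnZ4 (p j)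
  fixedPoints_eq : Function.fixedPoints σ = range p
  simplyConnected : SimplyConnectedSpace ((range p)ᶜ : Set Y)

/-! ### The quotient `Z = Y / ⟨σ⟩` and its desingularization -/

/-- The quotient `Z = Y / ⟨σ⟩`, with the quotient topology. -/
def OrbitSpace (σ : Y → Y) : Type _ := Quot fun y z : Y => σ y = z

instance (σ : Y → Y) : TopologicalSpace (OrbitSpace σ) :=
  inferInstanceAs (TopologicalSpace (Quot fun y z : Y => σ y = z))

/-- The projection `Y → Z`. -/
def OrbitSpace.mk (σ : Y → Y) (y : Y) : OrbitSpace σ := Quot.mk _ y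

/-- A smooth orbifold chart of `Y` at `p`, with group `⟨α⟩` and domain the ball of radius `2 ζ`
in `ℂ⁴ = ℝ⁸`, for which `v ↦ [c v]` descends to an injective map
`ψ : B_{2ζ}(ℝ⁸ / G) → Z` (which is then a homeomorphism onto an open set).

The typical example is `exp_p ∘ ι`, where `exp_p` is the exponential map of a `σ`-invariant metric,
`ζ` is small, and `ι` identifies `ℂ⁴ / ⟨α⟩` with the tangent space at `p` in such a way that
`β` corresponds to the derivative of `σ`. -/
structure IsResolutionChart (A : ComplexOrbifold Y) (σ : Y → Y) (p : Y) (ζ : ℝ)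
    (c : OrbifoldChart Y) : Prop where
  dom_eq : c.dom = ball 0 (2 * ζ)
  group_eq : c.Γ = Subgroup.zpowers alphaC
  map_zero : c.toFun 0 = p
  smooth : ∀ d ∈ A.atlas, LiftsTo RealSmooth id c d
  descends : ∀ v ∈ ball (0 : C4) (2 * ζ), ∀ w ∈ ball (0 : C4) (2 * ζ),
    OrbitSpace.mk σ (c.toFun v) = OrbitSpace.mk σ (c.toFun w) ↔ Cone.mk v = Cone.mk w

/-- The map `ψ : B_{2ζ}(ℝ⁸ / G) → Z` induced by the chart `c`. It is written as a function on all
of `ℝ⁸ / G`, of which only the values on the ball of radius `2 ζ` are used; there it does not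
depend on the choice of the representative (see `psi_mk`). -/
def psi (σ : Y → Y) (c : OrbifoldChart Y) (x : Cone) : OrbitSpace σ :=
  OrbitSpace.mk σ (c.toFun (Quotient.out x))

theorem psi_mk {A : ComplexOrbifold Y} {σ : Y → Y} {p : Y} {ζ : ℝ} {c : OrbifoldChart Y}
    (hc : IsResolutionChart A σ p ζ c) {v : C4} (hv : ‖v‖ < 2 * ζ) :
    psi σ c (Cone.mk v) = OrbitSpace.mk σ (c.toFun v) := by
  have h : Cone.mk (Quotient.out (Cone.mk v)) = Cone.mk v := Quotient.out_eq _
  have hn : ‖Quotient.out (Cone.mk v)‖ = ‖v‖ := congrArg Cone.radius h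
  exact (hc.descends _ (by simpa [hn] using hv) v (by simpa using hv)).2 h

/-- The image `U` under `ψ` of the ball of radius `2 ζ` in `ℝ⁸ / G`. -/
def chartImage (σ : Y → Y) (ζ : ℝ) (c : OrbifoldChart Y) : Set (OrbitSpace σ) :=
  psi σ c '' {x | x.radius < 2 * ζ}

section Gluing

variable (σ : Y → Y) (ζ : ℝ) {k : ℕ} (c : Fin k → OrbifoldChart Y) (n : Fin k → Kind) (t : ℝ)

/-- The open set `M₀ᵗ ⊆ Z`: the complement of the closed balls of radius `t^(4/5) ζ` about the
singular points. -/
def outerPiece : Set (OrbitSpace σ) :=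
  (⋃ j, psi σ (c j) '' {x | x.radius ≤ t ^ (4 / 5 : ℝ) * ζ})ᶜ

/-- The open set `Mⱼᵗ ⊆ X`: the inverse image under `πᵗ` of the ball of radius
`2 t^(4/5) ζ`. -/
def innerPiece (κ : Kind) : Set (ALE κ) :=
  {x | (x.projScaled t).radius < 2 * t ^ (4 / 5 : ℝ) * ζ}

/-- The gluing relation: `x ∈ Mⱼᵗ` is identified with `z ∈ M₀ᵗ` if `ψⱼ (πᵗ x) = z`. -/
inductive GlueRel :
    (outerPiece σ ζ c t ⊕ Σ j, innerPiece ζ t (n j)) →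
    (outerPiece σ ζ c t ⊕ Σ j, innerPiece ζ t (n j)) → Prop
  | glue (j : Fin k) (x : innerPiece ζ t (n j)) (z : outerPiece σ ζ c t)
      (h : psi σ (c j) (x.1.projScaled t) = z.1) : GlueRel (Sum.inl z) (Sum.inr ⟨j, x⟩)

/-- The resolution `Mᵗ` of `Z`: the disjoint union of `M₀ᵗ, M₁ᵗ, …, Mₖᵗ` modulo the equivalence
relation generated by the gluing relation, with the quotient topology. -/
def Resolution : Type _ := Quot (GlueRel σ ζ c n t)

instance : TopologicalSpace (Resolution σ ζ c n t) :=
  inferInstanceAs (TopologicalSpace (Quot (GlueRel σ ζ c n t)))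

end Gluing

end Spin7Resolution

end

open Spin7Resolution

/-!
The resolution `Mᵗ` is covered by two kinds of maps: `outerMap`, from the regular part `Y' = Y ∖
{p₁, …, pₖ}`, and `tubeMap`, from a tube of pairs `(a, w) ∈ ℂ × ℂ⁴` with `w ≠ 0` and `‖a w‖`
bounded, where `(a, w)` are homogeneous coordinates for the point `a w` on the line `[w]` of the
blow-up. Both maps are continuous and open. The first identifies `y` with `σ y` and nothing else,
so it is a double cover of the complement of the exceptional divisors. The second identifies `(a,
w)` with `(ε μ⁻¹ a, μ w)` and `(ε μ⁻¹ ā, μ β w)`, where `ε ^ 4 = 1` and `μ ≠ 0`.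

A point of an exceptional divisor has a neighbourhood whose points lie on lines close to a fixed
line `e`. The lines `w` and `β w` are orthogonal, so by Bessel's inequality the antilinear
identifications do not occur in it. Hence it can be contracted, and its part off the divisor is
path connected. By subdividing paths, as in the proof of van Kampen's theorem, every loop in `Mᵗ`
based in the image of `Y'` is homotopic to the image of a path in `Y'`
(`exists_lift_of_covering_off_contractible`). As `Y'` is simply connected, there are at most two
classes of loops: the trivial one, and the image of a path from `y` to `σ y`
(`DesingData.loop_class`).

If some `n j` is `X2`, then `σ` is, near `p j` and in the coordinates `w`, multiplication by `i`.
The path from `y` to `σ y` can then be taken to be a quarter of a circle in a complex line, whose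
image in `Mᵗ` lies in a contractible neighbourhood of a point of the exceptional divisor. So the
second class is trivial too (`DesingData.simplyConnectedSpace_resolution`).

If all `n j` are `X1`, then `Mᵗ` has a double cover which extends `Y'` by a copy of `ℂℙ³` for each
singular point, the crepant resolution of `Y`; the deck transformation is `[w] ↦ [β w]` on `ℂℙ³`,
which has no fixed points. The path from `y` to `σ y` is not closed in this cover, so its image in
`Mᵗ` is not null-homotopic (`DesingData.fundamentalGroup_resolution`).
-/

/-! ### Covering maps and homotopies of paths -/

section Topology

open scoped unitInterval

/-- A continuous open surjection with fibres of at most two points is a covering map as soon as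
every point `e` has a partner `e'` in its fibre such that `e` and `e'` lie in disjoint open sets on
which the map is injective: these are the two sheets over the intersection of their images. -/
theorem isCoveringMap_of_two_sheets {E X : Type*} [TopologicalSpace E] [TopologicalSpace X]
    {f : E → X} (hc : Continuous f) (ho : IsOpenMap f) (hs : Function.Surjective f)
    (h2 : ∀ a b c, f a = f b → f c = f a → a ≠ b → c = a ∨ c = b)
    (hU : ∀ e, ∃ e' : E, ∃ U U' : Set E, IsOpen U ∧ IsOpen U' ∧ e ∈ U ∧ e' ∈ U' ∧ f e' = f e ∧
      Disjoint U U' ∧ InjOn f U ∧ InjOn f U') :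
    IsCoveringMap f := by
  have key : ∀ x : X, ∃ t : Bundle.Trivialization Bool f, x ∈ t.baseSet := by
    intro x
    obtain ⟨e, rfl⟩ := hs x
    obtain ⟨e', U, U', hUo, hUo', heU, heU', he, hd, hi, hi'⟩ := hU e
    have : Nonempty (X → E) := ⟨fun _ => e⟩
    have hsurj : ∀ b : Bool, (cond b U U').SurjOn f (f '' U ∩ f '' U') := by
      rintro (_ | _) x ⟨hx, hx'⟩
      exacts [hx', hx]
    have hopen : ∀ b : Bool, IsOpen (cond b U U') := by rintro (_ | _) <;> assumption
    refine ⟨IsOpen.trivializationDiscrete (ι := Bool) (fun b => cond b U U') (f '' U ∩ f '' U')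
      ((ho _ hUo).inter (ho _ hUo')) ?_ ?_ hsurj ?_ ?_, ⟨e, heU, rfl⟩, ⟨e', heU', he⟩⟩
    · intro b W hW
      refine ⟨fun h => (h.preimage hc).inter (hopen b), fun h => ?_⟩
      have : f '' (f ⁻¹' W ∩ cond b U U') = W := by
        rw [image_preimage_inter, inter_eq_left]
        exact hW.trans (hsurj b)
      rw [← this]
      exact ho _ h
    · rintro (_ | _) <;> assumption
    · rintro (_ | _) (_ | _) h
      exacts [(h rfl).elim, hd.symm, hd, (h rfl).elim]
    · rintro c ⟨⟨a, haU, ha⟩, ⟨b, hbU, hb⟩⟩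
      have hab : a ≠ b := fun h => hd.le_bot ⟨haU, h ▸ hbU⟩
      rcases h2 a b c (ha.trans hb.symm) ha.symm hab with rfl | rfl
      exacts [mem_iUnion.2 ⟨true, haU⟩, mem_iUnion.2 ⟨false, hbU⟩]
  choose t ht using key
  exact IsCoveringMap.mk _ (fun _ => Bool) t ht

/-- A contraction of `B` that respects the fibres of an open map `q` descends to the image of `q`,
so paths with the same ends in this image are homotopic. Openness makes `id × q` a quotient map
onto its image, which gives the continuity of the descended contraction. -/
theorem homotopic_of_equivariant_contraction {B X : Type*} [TopologicalSpace B]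
    [TopologicalSpace X] {q : B → X} (hc : Continuous q) (ho : IsOpenMap q) (H : I × B → B)
    (hH : Continuous H) (b₀ : B) (h0 : ∀ b, q (H (0, b)) = q b₀) (h1 : ∀ b, H (1, b) = b)
    (hq : ∀ b b' s, q b = q b' → q (H (s, b)) = q (H (s, b')))
    {x y : X} (γ γ' : Path x y) (hγ : range γ ⊆ range q) (hγ' : range γ' ⊆ range q) :
    γ.Homotopic γ' := by
  let r : B → range q := rangeFactorization q
  have hrc : Continuous r := hc.subtype_mk _
  have hro : IsOpenMap r := ho.subtype_mk _
  have hrs : Function.Surjective r := rangeFactorization_surjective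
  have hprod : IsOpenQuotientMap (Prod.map (id : I → I) r) :=
    IsOpenQuotientMap.id.prodMap ⟨hrs, hrc, hro⟩
  let K : I × range q → range q := fun p => r (H (p.1, Function.surjInv hrs p.2))
  have hK : ∀ s b, K (s, r b) = r (H (s, b)) := by
    intro s b
    apply Subtype.ext
    apply hq
    exact congrArg Subtype.val (Function.surjInv_eq hrs (r b))
  have hKc : Continuous K := by
    rw [hprod.isQuotientMap.continuous_iff]
    have : K ∘ Prod.map (id : I → I) r = r ∘ H := by
      ext ⟨s, b⟩
      exact congrArg Subtype.val (hK s b)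
    rw [this]
    exact hrc.comp hH
  have hcontr : ContractibleSpace (range q) := by
    rw [contractible_iff_id_nullhomotopic]
    refine ⟨r b₀, ⟨ContinuousMap.Homotopy.symm ⟨⟨K, hKc⟩, ?_, ?_⟩⟩⟩
    · intro z
      obtain ⟨b, rfl⟩ := hrs z
      exact (hK 0 b).trans (Subtype.ext (h0 b))
    · intro z
      obtain ⟨b, rfl⟩ := hrs z
      simp [hK, h1]
  have hx : x ∈ range q := hγ ⟨0, γ.source⟩
  have hy : y ∈ range q := hγ ⟨1, γ.target⟩
  let lift : ∀ δ : Path x y, range δ ⊆ range q → Path (⟨x, hx⟩ : range q) ⟨y, hy⟩ :=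
    fun δ hδ =>
      { toFun := fun s => ⟨δ s, hδ ⟨s, rfl⟩⟩
        source' := by simp
        target' := by simp }
  have := (SimplyConnectedSpace.paths_homotopic (lift γ hγ) (lift γ' hγ')).map
    ⟨Subtype.val, continuous_subtype_val⟩
  exact this

/-- Lifts `η`, `η'` of path classes `Γ`, `Δ` can be composed. The ends of the lifts agree with those
of the paths only propositionally, whence the casts. -/
theorem map_trans_eq_cast {E X : Type*} [TopologicalSpace E] [TopologicalSpace X] (f : C(E, X))
    {a e e' : E} {x y : X} {η : Path.Homotopic.Quotient a e} {η' : Path.Homotopic.Quotient e e'}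
    {Γ : Path.Homotopic.Quotient x (f e)} {Δ : Path.Homotopic.Quotient (f e) y}
    {h : f a = x} {h' : f e' = y}
    (hη : η.map f = Γ.cast h rfl) (hη' : η'.map f = Δ.cast rfl h') :
    (η.trans η').map f = (Γ.trans Δ).cast h h' := by
  subst h h'
  simp only [Path.Homotopic.Quotient.cast_rfl_rfl] at *
  rw [← hη, ← hη']
  induction η, η' using Path.Homotopic.Quotient.ind₂ with | mk η η'
  rw [← Path.Homotopic.Quotient.mk_trans, ← Path.Homotopic.Quotient.mk_map, Path.map_trans]
  rfl

open Path in
/-- Suppose that the open sets `U i` cover `X`, that every path in `U i` with ends in the range of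
`f` is homotopic to the image of a path upstairs, and that every point of `X` can be joined to the
range of `f` within any neighbourhood. Then every path with ends in the range of `f` is homotopic
to the image of a path upstairs, with prescribed starting point. The path is subdivided by the
Lebesgue number lemma, and each division point is moved into the range of `f` along a short
detour. -/
theorem exists_lift_homotopic_of_cover {E X ι : Type*} [TopologicalSpace E] [TopologicalSpace X]
    (f : C(E, X)) (U : ι → Set X) (hU : ∀ i, IsOpen (U i)) (hcov : ∀ x, ∃ i, x ∈ U i)
    (happ : ∀ x, ∀ O : Set X, IsOpen O → x ∈ O → ∃ (e : E) (γ : Path x (f e)), range γ ⊆ O)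
    (hlift : ∀ i (a b : E) (γ : Path (f a) (f b)), range γ ⊆ U i →
      ∃ (e : E) (h : f e = f b) (δ : Homotopic.Quotient a e),
        δ.map f = (Homotopic.Quotient.mk γ).cast rfl h)
    {a b : E} (γ : Path (f a) (f b)) :
    ∃ (e : E) (h : f e = f b) (δ : Homotopic.Quotient a e),
      δ.map f = (Homotopic.Quotient.mk γ).cast rfl h := by
  obtain ⟨t, t0, tmono, ⟨N, hN⟩, hseg⟩ :=
    exists_monotone_Icc_subset_open_cover_unitInterval (c := fun i => γ ⁻¹' U i)
      (fun i => (hU i).preimage γ.continuous) (fun s _ => by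
        obtain ⟨i, hi⟩ := hcov (γ s)
        exact mem_iUnion.2 ⟨i, hi⟩)
  have h0 : f a = γ (t 0) := by rw [t0]; simp
  have main : ∀ n i, γ (t n) ∈ U i → ∃ (e : E) (δ : Path (γ (t n)) (f e))
      (η : Homotopic.Quotient a e), range δ ⊆ U i ∧ η.map f =
        ((Homotopic.Quotient.mk (γ.subpath (t 0) (t n))).trans (.mk δ)).cast h0 rfl := by
    intro n
    induction n with
    | zero =>
      intro i hi
      refine ⟨a, (Path.refl (f a)).cast h0.symm rfl, .refl a, ?_, ?_⟩
      · rintro _ ⟨s, rfl⟩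
        simpa [h0] using hi
      · rw [Path.subpath_self]
        clear hi
        revert h0
        generalize γ (t 0) = z
        rintro rfl
        simp only [Homotopic.Quotient.mk_refl, Homotopic.Quotient.mk_cast,
          Homotopic.Quotient.refl_trans, Homotopic.Quotient.cast_rfl_rfl]
        rfl
    | succ n ih =>
      intro i' hi'
      obtain ⟨i, hi⟩ := hseg n
      obtain ⟨e, δ, η, hδ, hη⟩ := ih i (hi ⟨le_rfl, tmono n.le_succ⟩)
      obtain ⟨e₁, δ₁, hδ₁⟩ := happ (γ (t (n + 1))) (U i ∩ U i') ((hU i).inter (hU i'))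
        ⟨hi ⟨tmono n.le_succ, le_rfl⟩, hi'⟩
      obtain ⟨e₂, he₂, η₂, hη₂⟩ := hlift i e e₁
        ((δ.symm.trans (γ.subpath (t n) (t (n + 1)))).trans δ₁) (by
          rw [Path.trans_range, Path.trans_range, Path.symm_range,
            Path.range_subpath_of_le _ _ _ (tmono n.le_succ)]
          refine union_subset (union_subset hδ ?_) (hδ₁.trans inter_subset_left)
          rintro _ ⟨s, hs, rfl⟩
          exact hi hs)
      refine ⟨e₂, δ₁.cast rfl he₂, η.trans η₂, ?_, ?_⟩
      · simpa using hδ₁.trans inter_subset_right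
      · rw [map_trans_eq_cast f hη hη₂]
        have h3 : Homotopic.Quotient.mk (γ.subpath (t 0) (t (n + 1))) =
            (Homotopic.Quotient.mk (γ.subpath (t 0) (t n))).trans
              (.mk (γ.subpath (t n) (t (n + 1)))) :=
          (Homotopic.Quotient.eq.2 ⟨Homotopy.subpathTransSubpath γ _ _ _⟩).symm
        rw [h3]
        clear hη hη₂
        revert he₂
        generalize f e₂ = z
        rintro rfl
        simp only [Homotopic.Quotient.mk_trans, Homotopic.Quotient.mk_symm, Path.cast_rfl_rfl,
          Homotopic.Quotient.trans_assoc]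
        rw [← Homotopic.Quotient.trans_assoc (Homotopic.Quotient.mk δ),
          Homotopic.Quotient.trans_symm, Homotopic.Quotient.refl_trans]
  obtain ⟨i, hi⟩ := hcov (γ (t N))
  obtain ⟨e, δ, η, hδ, hη⟩ := main N i hi
  have h1 : γ (t N) = f b := by rw [hN N le_rfl]; simp
  obtain ⟨e₂, he₂, η₂, hη₂⟩ := hlift i e b (δ.symm.cast rfl h1.symm) (by simpa using hδ)
  refine ⟨e₂, he₂, η.trans η₂, ?_⟩
  rw [map_trans_eq_cast f hη hη₂]
  have h3 : Homotopic.Quotient.mk (γ.subpath (t 0) (t N)) =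
      (Homotopic.Quotient.mk γ).cast h0.symm h1 := by
    rw [← Homotopic.Quotient.mk_cast]
    congr 1
    have : ∀ u v (h : f a = γ u) (h' : γ v = f b), u = 0 → v = 1 →
        γ.subpath u v = γ.cast h.symm h' := by
      rintro _ _ h h' rfl rfl
      exact γ.subpath_zero_one
    exact this _ _ h0 h1 t0 (hN N le_rfl)
  rw [h3]
  clear hη hη₂ h3 main
  revert h1 h0
  generalize γ (t N) = z at δ hi ⊢
  generalize γ (t 0) = z'
  rintro rfl rfl
  simp only [Path.cast_rfl_rfl, Homotopic.Quotient.mk_symm, Homotopic.Quotient.cast_rfl_rfl]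
  rw [Homotopic.Quotient.trans_assoc, Homotopic.Quotient.trans_symm,
    Homotopic.Quotient.trans_refl]

open Path in
/-- A weak form of van Kampen's theorem: let `f` be a covering map onto an open set which can be
reached from every point of `X` within any neighbourhood, and let every other point have an open
neighbourhood `U` in which paths with the same ends are homotopic and over which points upstairs
can be joined up to the choice of the preimage. Then every path in `X` with ends in the range of
`f` is homotopic to the image of a path upstairs. -/
theorem exists_lift_of_covering_off_contractible {E X : Type*} [TopologicalSpace E]
    [TopologicalSpace X] (f : C(E, X)) (ho : IsOpenMap f)
    (hcov : IsCoveringMap (rangeFactorization f))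
    (happ : ∀ x, ∀ O : Set X, IsOpen O → x ∈ O → ∃ (e : E) (γ : Path x (f e)), range γ ⊆ O)
    (hloc : ∀ x, x ∉ range f → ∃ U : Set X, IsOpen U ∧ x ∈ U ∧
      (∀ (y z : X) (γ γ' : Path y z), range γ ⊆ U → range γ' ⊆ U → γ.Homotopic γ') ∧
      ∀ a b : E, f a ∈ U → f b ∈ U → ∃ (e : E) (δ : Path a e), f e = f b ∧ ∀ s, f (δ s) ∈ U)
    {a b : E} (γ : Path (f a) (f b)) :
    ∃ (e : E) (h : f e = f b) (δ : Homotopic.Quotient a e),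
      δ.map f = (Homotopic.Quotient.mk γ).cast rfl h := by
  choose! V hVo hxV hV hVlift using hloc
  refine exists_lift_homotopic_of_cover f
    (fun o : Option {x // x ∉ range f} => o.elim (range f) fun x => V x) ?_ ?_ happ ?_ γ
  · rintro (_ | ⟨x, hx⟩)
    exacts [ho.isOpen_range, hVo x hx]
  · intro x
    by_cases hx : x ∈ range f
    exacts [⟨none, hx⟩, ⟨some ⟨x, hx⟩, hxV x hx⟩]
  · rintro (_ | ⟨x, hx⟩) a b γ hγ
    · let g : C(I, range f) := ⟨fun s => ⟨γ s, hγ ⟨s, rfl⟩⟩, γ.continuous.subtype_mk _⟩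
      have h0 : g 0 = rangeFactorization f a := Subtype.ext γ.source
      obtain ⟨Γ, hΓ, hΓ0⟩ := hcov.exists_path_lifts g a h0
      have hΓ' : ∀ s, f (Γ s) = γ s := fun s => congrArg Subtype.val (congrFun hΓ s)
      refine ⟨Γ 1, by simp [hΓ'], .mk ⟨Γ, hΓ0, rfl⟩, ?_⟩
      rw [← Homotopic.Quotient.mk_map, ← Homotopic.Quotient.mk_cast]
      congr 1
      ext s
      exact hΓ' s
    · obtain ⟨e, δ, he, hδ⟩ := hVlift x hx a b (hγ ⟨0, γ.source⟩) (hγ ⟨1, γ.target⟩)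
      refine ⟨e, he, .mk δ, ?_⟩
      rw [← Homotopic.Quotient.mk_map, ← Homotopic.Quotient.mk_cast, Homotopic.Quotient.eq]
      refine hV x hx _ _ _ _ ?_ ?_
      · rintro _ ⟨s, rfl⟩
        exact hδ s
      · rintro _ ⟨s, rfl⟩
        exact hγ ⟨s, rfl⟩

open Path in
/-- If `E` is simply connected, two points of a fibre of `f` are equal or exchanged by `τ`, and
paths lift up to homotopy, then the loops at `f e₀` form at most two classes: the trivial one and
that of the image of a path from `e₀` to `τ e₀`. -/
theorem loop_class_of_double_cover {E X : Type*} [TopologicalSpace E]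
    [TopologicalSpace X] [SimplyConnectedSpace E] (f : C(E, X)) (τ : E → E)
    (hfib : ∀ e e', f e = f e' → e' = e ∨ e' = τ e)
    (hlift : ∀ {a b : E} (γ : Path (f a) (f b)), ∃ (e : E) (h : f e = f b)
      (δ : Homotopic.Quotient a e), δ.map f = (Homotopic.Quotient.mk γ).cast rfl h)
    (e₀ : E) (h₀ : f (τ e₀) = f e₀) (δ₀ : Homotopic.Quotient e₀ (τ e₀))
    (Γ : Homotopic.Quotient (f e₀) (f e₀)) :
    Γ = .refl _ ∨ Γ = (δ₀.map f).cast rfl h₀.symm := by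
  induction Γ using Homotopic.Quotient.ind with | mk γ
  obtain ⟨e, h, δ, hδ⟩ := hlift γ
  rcases hfib _ _ h.symm with rfl | rfl
  · left
    rw [Homotopic.Quotient.cast_rfl_rfl] at hδ
    rw [← hδ, Subsingleton.elim δ (.refl _)]
    rfl
  · right
    rw [Subsingleton.elim δ₀ δ, hδ, Homotopic.Quotient.cast_cast, Homotopic.Quotient.cast_rfl_rfl]

theorem pathConnectedSpace_of_approach {E X : Type*} [TopologicalSpace E]
    [TopologicalSpace X] [PathConnectedSpace E] (f : C(E, X))
    (happ : ∀ x, ∀ O : Set X, IsOpen O → x ∈ O → ∃ (e : E) (γ : Path x (f e)), range γ ⊆ O) :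
    PathConnectedSpace X := by
  have key : ∀ x, ∃ e, Joined x (f e) := fun x => by
    obtain ⟨e, γ, -⟩ := happ x univ isOpen_univ trivial
    exact ⟨e, ⟨γ⟩⟩
  refine ⟨‹PathConnectedSpace E›.nonempty.map f, fun x y => ?_⟩
  obtain ⟨e, he⟩ := key x
  obtain ⟨e', he'⟩ := key y
  exact (he.trans ((PathConnectedSpace.joined e e').map f.continuous)).trans he'.symm

open Path in
theorem simplyConnectedSpace_of_loops_eq_refl {X : Type*} [TopologicalSpace X]
    [PathConnectedSpace X] (x : X) (h : ∀ Γ : Homotopic.Quotient x x, Γ = .refl x) :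
    SimplyConnectedSpace X := by
  rw [simply_connected_iff_loops_nullhomotopic]
  refine ⟨inferInstance, fun y γ => ?_⟩
  have e := FundamentalGroup.fundamentalGroupMulEquivOfPathConnected (X := X) y x
  have : Subsingleton (FundamentalGroup X x) := ⟨fun a b => (h a).trans (h b).symm⟩
  have : Subsingleton (FundamentalGroup X y) := e.toEquiv.subsingleton
  exact Homotopic.Quotient.eq.1
    (Subsingleton.elim (α := FundamentalGroup X y) (Homotopic.Quotient.mk γ)
      (Homotopic.Quotient.mk (Path.refl y)))

open Path in
theorem fundamentalGroup_mulEquiv_zmod_two {X : Type*} [TopologicalSpace X]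
    [PathConnectedSpace X] (x : X) (Γ₀ : Homotopic.Quotient x x)
    (h : ∀ Γ : Homotopic.Quotient x x, Γ = .refl x ∨ Γ = Γ₀) (hne : Γ₀ ≠ .refl x) (y : X) :
    Nonempty (FundamentalGroup X y ≃* Multiplicative (ZMod 2)) := by
  have e := FundamentalGroup.fundamentalGroupMulEquivOfPathConnected (X := X) y x
  have hcard : Nat.card (FundamentalGroup X x) = 2 := by
    rw [Nat.card_eq_two_iff]
    exact ⟨(Homotopic.Quotient.refl x : FundamentalGroup X x), Γ₀, hne.symm,
      eq_univ_of_forall fun Γ => h Γ⟩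
  exact ⟨e.trans (mulEquivOfPrimeCardEq (p := 2) hcard (by simp))⟩

open Path in
/-- The image under a covering map of a path between distinct points of a fibre is not
null-homotopic. -/
theorem map_ne_refl_of_isCoveringMap {E X : Type*} [TopologicalSpace E] [TopologicalSpace X]
    {p : C(E, X)} (hp : IsCoveringMap p) {a b : E} (hab : a ≠ b) (h : p b = p a)
    (δ : Homotopic.Quotient a b) : (δ.map p).cast rfl h.symm ≠ .refl (p a) := by
  intro h0
  apply hab
  have h1 := hp.monodromy_eq_of_map_eq (γ := .refl (p a)) (ex := ⟨a, rfl⟩) (ey := ⟨b, h⟩) δ (by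
    rw [← h0]
    exact (((δ.map p).cast_cast rfl h.symm rfl h).trans (δ.map p).cast_rfl_rfl).symm)
  rw [hp.monodromy_refl] at h1
  exact congrArg Subtype.val h1

end Topology

/-! ### The group `G` in the coordinates of either resolution -/

section LinearModel

theorem exists_eq_I_pow {ε : ℂ} (hε : ε ^ 4 = 1) : ∃ k : ℕ, ε = Complex.I ^ k := by
  have h : (ε - 1) * (ε + 1) * ((ε - Complex.I) * (ε + Complex.I)) = 0 := by
    linear_combination hε + (1 - ε ^ 2) * Complex.I_sq
  rcases mul_eq_zero.1 h with h | h <;> rcases mul_eq_zero.1 h with h | h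
  · exact ⟨0, by rw [pow_zero]; linear_combination h⟩
  · exact ⟨2, by rw [Complex.I_sq]; linear_combination h⟩
  · exact ⟨1, by rw [pow_one]; linear_combination h⟩
  · exact ⟨3, by rw [Complex.I_pow_three]; linear_combination h⟩

theorem c4Isometry_mul_apply (g h : C4 ≃ₗᵢ[ℝ] C4) (v : C4) : (g * h) v = g (h v) := rfl

theorem beta_smul (ε : ℂ) (v : C4) : beta (ε • v) = starRingEnd ℂ ε • beta v := by
  ext i; fin_cases i <;> simp [beta]

theorem beta_beta (v : C4) : beta (beta v) = -v := by
  ext i; fin_cases i <;> simp [beta]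

theorem inner_beta_self (v : C4) : inner ℂ v (beta v) = 0 := by
  simp [beta, PiLp.inner_apply, Fin.sum_univ_four]
  ring

theorem beta_ne_zero {v : C4} (hv : v ≠ 0) : beta v ≠ 0 := by
  simpa using hv

/-- In the coordinates `κ.coord`, multiplication by `i` and the map `β` both belong to `G`; for
`Kind.X2` they are the images of `β` and of `α`. -/
theorem coord_generators (κ : Kind) :
    (∃ g ∈ G, ∀ v, κ.coord (g v) = Complex.I • κ.coord v) ∧
      ∃ g ∈ G, ∀ v, κ.coord (g v) = beta (κ.coord v) := by
  have ha : alpha ∈ G := Subgroup.subset_closure (by simp)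
  have hb : beta ∈ G := Subgroup.subset_closure (by simp)
  cases κ
  · exact ⟨⟨alpha, ha, fun v => rfl⟩, ⟨beta, hb, fun v => rfl⟩⟩
  · refine ⟨⟨beta, hb, fun v => ?_⟩, ⟨alpha, ha, fun v => ?_⟩⟩
    · ext i; fin_cases i <;> simp [Kind.coord, coordW, beta, Complex.ext_iff]
    · have : alpha v = Complex.I • v := rfl
      rw [this]
      ext i; fin_cases i <;> simp [Kind.coord, coordW, beta, Complex.ext_iff]

/-- In the coordinates `κ.coord` the elements of `G` are `v ↦ ε v` and `v ↦ ε β v` with `ε ^ 4 = 1`,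
for both kinds of resolution. -/
theorem coord_mem_G (κ : Kind) {g : C4 ≃ₗᵢ[ℝ] C4} (hg : g ∈ G) :
    ∃ ε : ℂ, ε ^ 4 = 1 ∧ ((∀ v, κ.coord (g v) = ε • κ.coord v) ∨
      ∀ v, κ.coord (g v) = ε • beta (κ.coord v)) := by
  have hI : Complex.I ^ 4 = 1 := Complex.I_pow_four
  induction hg using Subgroup.closure_induction with
  | mem g hg =>
    rcases hg with rfl | rfl <;> cases κ
    · exact ⟨Complex.I, hI, .inl fun v => rfl⟩
    · refine ⟨1, by simp, .inr fun v => ?_⟩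
      have : alpha v = Complex.I • v := rfl
      rw [this]
      ext i; fin_cases i <;> simp [Kind.coord, coordW, beta, Complex.ext_iff]
    · exact ⟨1, by simp, .inr fun v => by simp [Kind.coord]⟩
    · refine ⟨Complex.I, hI, .inl fun v => ?_⟩
      ext i; fin_cases i <;> simp [Kind.coord, coordW, beta, Complex.ext_iff]
  | one => exact ⟨1, by simp, .inl fun v => by simp⟩
  | mul g h _ _ ihg ihh =>
    obtain ⟨ε, hε, h1⟩ := ihg
    obtain ⟨δ, hδ, h2⟩ := ihh
    have hδ' : (starRingEnd ℂ δ) ^ 4 = 1 := by rw [← map_pow, hδ, map_one]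
    rcases h1 with h1 | h1 <;> rcases h2 with h2 | h2
    · exact ⟨ε * δ, by rw [mul_pow, hε, hδ, one_mul], .inl fun v => by
        rw [c4Isometry_mul_apply, h1, h2, smul_smul]⟩
    · exact ⟨ε * δ, by rw [mul_pow, hε, hδ, one_mul], .inr fun v => by
        rw [c4Isometry_mul_apply, h1, h2, smul_smul]⟩
    · exact ⟨ε * starRingEnd ℂ δ, by rw [mul_pow, hε, hδ', one_mul], .inr fun v => by
        rw [c4Isometry_mul_apply, h1, h2, beta_smul, smul_smul]⟩
    -- the sign comes from `β² = -1`
    · refine ⟨-(ε * starRingEnd ℂ δ), ?_, .inl fun v => ?_⟩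
      · rw [neg_pow, mul_pow, hε, hδ']; norm_num
      · rw [c4Isometry_mul_apply, h1, h2, beta_smul, beta_beta, smul_smul, smul_neg,
          neg_smul]
  | inv g _ ih =>
    obtain ⟨ε, hε, h1⟩ := ih
    have hε0 : ε ≠ 0 := by rintro rfl; simp at hε
    have hg : ∀ v, g (g⁻¹ v) = v := fun v => g.apply_symm_apply v
    rcases h1 with h1 | h1
    · refine ⟨ε⁻¹, by rw [inv_pow, hε, inv_one], .inl fun v => ?_⟩
      rw [eq_inv_smul_iff₀ hε0, ← h1, hg]
    · have hc0 : starRingEnd ℂ ε ≠ 0 := by simpa using hε0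
      refine ⟨-(starRingEnd ℂ ε)⁻¹, ?_, .inr fun v => ?_⟩
      · rw [neg_pow, inv_pow, ← map_pow, hε]; norm_num
      · conv_rhs => rw [← hg v, h1, beta_smul, beta_beta]
        rw [smul_smul, neg_mul, inv_mul_cancel₀ hc0]
        simp

theorem exists_mem_G_coord (κ : Kind) {ε : ℂ} (hε : ε ^ 4 = 1) :
    (∃ g ∈ G, ∀ v, κ.coord (g v) = ε • κ.coord v) ∧
      ∃ g ∈ G, ∀ v, κ.coord (g v) = ε • beta (κ.coord v) := by
  obtain ⟨⟨a, ha, hav⟩, ⟨b, hb, hbv⟩⟩ := coord_generators κ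
  have hpow : ∀ k : ℕ, ∀ v, κ.coord ((a ^ k) v) = Complex.I ^ k • κ.coord v := by
    intro k
    induction k with
    | zero => simp
    | succ k ih =>
      intro v
      rw [pow_succ', c4Isometry_mul_apply, hav, ih, smul_smul, pow_succ']
  obtain ⟨k, rfl⟩ := exists_eq_I_pow hε
  refine ⟨⟨a ^ k, pow_mem ha k, hpow k⟩, ⟨a ^ k * b, mul_mem (pow_mem ha k) hb, fun v => ?_⟩⟩
  rw [c4Isometry_mul_apply, hpow, hbv]

/-- The relation under which two pairs `(a, w)`, standing for the point `(a w, [w])` of the blow-up,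
represent the same point modulo `G`. The factor `μ` rescales the homogeneous coordinate `w`, and
`ε`, `β` give the action of `G`. -/
def OrbitRel (q q' : ℂ × C4) : Prop :=
  ∃ ε μ : ℂ, ε ^ 4 = 1 ∧ μ ≠ 0 ∧
    (q' = (ε * μ⁻¹ * q.1, μ • q.2) ∨ q' = (ε * μ⁻¹ * starRingEnd ℂ q.1, μ • beta q.2))

/-- Homogeneous coordinates on the blow-up of `ℂ⁴` at `0`: the pair `(a, w)` stands for the point
`a w` on the line `[w]`. -/
abbrev Hom4 : Type := {q : ℂ × C4 // q.2 ≠ 0}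

/-- The point of the blow-up with homogeneous coordinates `(a, w)`, that is the point `a w` (in the
coordinates `κ.coord`) on the line `[w]`. -/
noncomputable def blowUpMk (κ : Kind) (q : Hom4) : BlowUp κ :=
  ⟨(κ.coord.symm (q.1.1 • q.1.2), Projectivization.mk ℂ q.1.2 q.2), by
    rw [LinearIsometryEquiv.apply_symm_apply, Projectivization.submodule_mk]
    exact Submodule.smul_mem _ _ (Submodule.mem_span_singleton_self _)⟩

/-- The point of the resolution `X₁` or `X₂` with homogeneous coordinates `(a, w)`. -/
noncomputable def aleMk (κ : Kind) (q : Hom4) : ALE κ := Quotient.mk (blowUpSetoid κ) (blowUpMk κ q)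

theorem blowUpMk_surjective (κ : Kind) : Function.Surjective (blowUpMk κ) := by
  rintro ⟨⟨v, l⟩, h⟩
  induction l using Projectivization.ind with | h w hw
  simp only [Projectivization.submodule_mk, Submodule.mem_span_singleton] at h
  obtain ⟨a, ha⟩ := h
  refine ⟨⟨(a, w), hw⟩, Subtype.ext (Prod.ext ?_ rfl)⟩
  simp [blowUpMk, ha]

theorem aleMk_surjective (κ : Kind) : Function.Surjective (aleMk κ) :=
  Quotient.mk_surjective.comp (blowUpMk_surjective κ)

theorem blowUpRel_iff (κ : Kind) (q q' : Hom4) :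
    (∃ g ∈ G, g (κ.coord.symm (q.1.1 • q.1.2)) = κ.coord.symm (q'.1.1 • q'.1.2) ∧
      (fun z => κ.coord (g (κ.coord.symm z))) '' (Submodule.span ℂ {q.1.2} : Set C4) =
        (Submodule.span ℂ {q'.1.2} : Set C4)) ↔ OrbitRel q.1 q'.1 := by
  obtain ⟨⟨l, w⟩, hw⟩ := q
  obtain ⟨⟨l', w'⟩, hw'⟩ := q'
  simp only at hw hw' ⊢
  constructor
  · rintro ⟨g, hg, h1, h2⟩
    obtain ⟨ε, hε, h⟩ := coord_mem_G κ hg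
    have hε0 : ε ≠ 0 := by rintro rfl; simp at hε
    have h1' := congrArg κ.coord h1
    have h3 : κ.coord (g (κ.coord.symm w)) ∈ (Submodule.span ℂ {w'} : Set C4) :=
      h2 ▸ ⟨w, Submodule.mem_span_singleton_self _, rfl⟩
    obtain ⟨c, hc⟩ := Submodule.mem_span_singleton.1 h3
    have hc0 : c ≠ 0 := by
      rintro rfl
      rw [zero_smul, eq_comm] at hc
      simp [hw] at hc
    refine ⟨ε, ε * c⁻¹, hε, mul_ne_zero hε0 (inv_ne_zero hc0), ?_⟩
    rcases h with h | h
    · left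
      rw [h, LinearIsometryEquiv.apply_symm_apply] at hc
      rw [h, LinearIsometryEquiv.apply_symm_apply, LinearIsometryEquiv.apply_symm_apply] at h1'
      have e2 : w' = (ε * c⁻¹) • w := by
        rw [mul_comm, mul_smul, ← hc, smul_smul, inv_mul_cancel₀ hc0, one_smul]
      refine Prod.ext ?_ e2
      rw [e2, smul_smul, smul_smul] at h1'
      have := smul_left_injective ℂ hw h1'
      field_simp at this ⊢
      rw [this]
    · right
      rw [h, LinearIsometryEquiv.apply_symm_apply] at hc
      rw [h, LinearIsometryEquiv.apply_symm_apply, LinearIsometryEquiv.apply_symm_apply,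
        beta_smul] at h1'
      have e2 : w' = (ε * c⁻¹) • beta w := by
        rw [mul_comm, mul_smul, ← hc, smul_smul, inv_mul_cancel₀ hc0, one_smul]
      refine Prod.ext ?_ e2
      rw [e2, smul_smul, smul_smul] at h1'
      have := smul_left_injective ℂ (beta_ne_zero hw) h1'
      field_simp at this ⊢
      rw [this]
  · rintro ⟨ε, μ, hε, hμ, h⟩
    have hε0 : ε ≠ 0 := by rintro rfl; simp at hε
    obtain ⟨⟨a, ha, hav⟩, ⟨b, hb, hbv⟩⟩ := exists_mem_G_coord κ hε
    rcases h with h | h <;> obtain ⟨rfl, rfl⟩ := Prod.ext_iff.1 h <;> dsimp only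
    · refine ⟨a, ha, ?_, ?_⟩
      · apply κ.coord.injective
        rw [hav]
        simp only [LinearIsometryEquiv.apply_symm_apply, smul_smul]
        congr 1
        field_simp
      · ext z
        simp only [hav, LinearIsometryEquiv.apply_symm_apply, mem_image, SetLike.mem_coe,
          Submodule.mem_span_singleton]
        constructor
        · rintro ⟨_, ⟨c, rfl⟩, rfl⟩
          exact ⟨ε * c * μ⁻¹, by simp only [smul_smul]; congr 1; field_simp⟩
        · rintro ⟨c, rfl⟩
          exact ⟨_, ⟨ε⁻¹ * c * μ, rfl⟩, by simp only [smul_smul]; congr 1; field_simp⟩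
    · refine ⟨b, hb, ?_, ?_⟩
      · apply κ.coord.injective
        rw [hbv]
        simp only [LinearIsometryEquiv.apply_symm_apply, beta_smul, smul_smul]
        congr 1
        field_simp
      · ext z
        simp only [hbv, LinearIsometryEquiv.apply_symm_apply, mem_image, SetLike.mem_coe,
          Submodule.mem_span_singleton]
        constructor
        · rintro ⟨_, ⟨c, rfl⟩, rfl⟩
          exact ⟨ε * starRingEnd ℂ c * μ⁻¹, by
            simp only [beta_smul, smul_smul]; congr 1; field_simp⟩
        · rintro ⟨c, rfl⟩
          exact ⟨_, ⟨starRingEnd ℂ (ε⁻¹ * c * μ), rfl⟩, by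
            simp only [beta_smul, smul_smul, Complex.conj_conj]; congr 1; field_simp⟩

theorem aleMk_eq_iff (κ : Kind) (q q' : Hom4) : aleMk κ q = aleMk κ q' ↔ OrbitRel q.1 q'.1 := by
  rw [← blowUpRel_iff κ]
  refine (Quotient.eq (r := blowUpSetoid κ)).trans ?_
  change (∃ g ∈ G, _ ∧ _) ↔ _
  simp only [blowUpMk, Projectivization.submodule_mk]

theorem continuous_projMk :
    Continuous fun v : {v : C4 // v ≠ 0} => Projectivization.mk ℂ v.1 v.2 :=
  continuous_coinduced_rng

theorem isOpenMap_projMk :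
    IsOpenMap fun v : {v : C4 // v ≠ 0} => Projectivization.mk ℂ v.1 v.2 := by
  intro V hV
  rw [isOpen_coinduced]
  have : ((fun v : {v : C4 // v ≠ 0} => Projectivization.mk ℂ v.1 v.2) ⁻¹'
      ((fun v : {v : C4 // v ≠ 0} => Projectivization.mk ℂ v.1 v.2) '' V)) =
      ⋃ a : ℂˣ, (fun v : {v : C4 // v ≠ 0} =>
        (⟨(a : ℂ) • v.1, smul_ne_zero a.ne_zero v.2⟩ : {v : C4 // v ≠ 0})) ⁻¹' V := by
    ext v
    simp only [mem_preimage, mem_image, mem_iUnion, Projectivization.mk_eq_mk_iff]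
    constructor
    · rintro ⟨w, hw, a, ha⟩
      refine ⟨a, ?_⟩
      convert hw
      exact ha
    · rintro ⟨a, ha⟩
      exact ⟨_, ha, a, rfl⟩
  rw [this]
  exact isOpen_iUnion fun a => hV.preimage (by fun_prop)

theorem continuous_blowUpMk (κ : Kind) : Continuous (blowUpMk κ) := by
  refine Continuous.subtype_mk (Continuous.prodMk ?_ ?_) _
  · exact κ.coord.symm.continuous.comp (by fun_prop)
  · exact continuous_projMk.comp (f := fun q : Hom4 => ⟨q.1.2, q.2⟩) (by fun_prop)

/-- The coordinate `a` of the point `v` on the line `[w]` is `⟪w, v⟫ / ⟪w, w⟫`, which depends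
continuously on `v` and `w`; so the openness of `w ↦ [w]` suffices. -/
theorem isOpenMap_blowUpMk (κ : Kind) : IsOpenMap (blowUpMk κ) := by
  intro O hO
  let r : C4 × {w : C4 // w ≠ 0} → Hom4 := fun x =>
    ⟨(inner ℂ x.2.1 (κ.coord x.1) / inner ℂ x.2.1 x.2.1, x.2.1), x.2.2⟩
  have hr : Continuous r := by
    refine Continuous.subtype_mk (Continuous.prodMk (Continuous.div ?_ ?_ ?_) (by fun_prop)) _
    · exact Continuous.inner (by fun_prop) (κ.coord.continuous.comp continuous_fst)
    · exact Continuous.inner (by fun_prop) (by fun_prop)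
    · intro x
      exact inner_self_ne_zero.2 x.2.2
  have hN := (IsOpenMap.id (X := C4)).prodMap isOpenMap_projMk _ (hO.preimage hr)
  refine ⟨_, hN, ?_⟩
  have key : ∀ (a : ℂ) (w : C4) (hw : w ≠ 0), r (κ.coord.symm (a • w), ⟨w, hw⟩) = ⟨(a, w), hw⟩ := by
    intro a w hw
    refine Subtype.ext (Prod.ext ?_ rfl)
    simp only [r, LinearIsometryEquiv.apply_symm_apply, inner_smul_right]
    rw [mul_div_assoc, div_self (inner_self_ne_zero.2 hw), mul_one]
  ext b
  constructor
  · rintro ⟨⟨v, ⟨w, hw⟩⟩, hvw, hb⟩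
    have hb1 : v = b.1.1 := congrArg Prod.fst hb
    have hb2 : Projectivization.mk ℂ w hw = b.1.2 := congrArg Prod.snd hb
    have h := b.2
    rw [← hb2, ← hb1, Projectivization.submodule_mk, Submodule.mem_span_singleton] at h
    obtain ⟨a, ha⟩ := h
    have hv : v = κ.coord.symm (a • w) := by rw [ha, LinearIsometryEquiv.symm_apply_apply]
    rw [mem_preimage, hv, key] at hvw
    refine ⟨_, hvw, Subtype.ext (Prod.ext ?_ hb2)⟩
    exact hv.symm.trans hb1
  · rintro ⟨⟨⟨a, w⟩, hw⟩, hq, rfl⟩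
    exact ⟨(κ.coord.symm (a • w), ⟨w, hw⟩), by rw [mem_preimage, key]; exact hq, rfl⟩

theorem isQuotientMap_aleMk (κ : Kind) : IsQuotientMap (aleMk κ) :=
  (isQuotientMap_quotient_mk' (s := blowUpSetoid κ)).comp
    ((isOpenMap_blowUpMk κ).isQuotientMap (continuous_blowUpMk κ) (blowUpMk_surjective κ))

theorem continuous_aleMk (κ : Kind) : Continuous (aleMk κ) := (isQuotientMap_aleMk κ).continuous

theorem OrbitRel.isOpen_saturation {V : Set (ℂ × C4)} (hV : IsOpen V) :
    IsOpen {q | ∃ q' ∈ V, OrbitRel q q'} := by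
  have : {q | ∃ q' ∈ V, OrbitRel q q'} = ⋃ (ε : ℂ) (μ : ℂ) (_ : ε ^ 4 = 1 ∧ μ ≠ 0),
      ((fun q : ℂ × C4 => (ε * μ⁻¹ * q.1, μ • q.2)) ⁻¹' V ∪
        (fun q : ℂ × C4 => (ε * μ⁻¹ * starRingEnd ℂ q.1, μ • beta q.2)) ⁻¹' V) := by
    ext q
    simp only [OrbitRel, mem_ofPred_eq, mem_iUnion, mem_union, mem_preimage]
    constructor
    · rintro ⟨q', hq', ε, μ, hε, hμ, rfl | rfl⟩
      exacts [⟨ε, μ, ⟨hε, hμ⟩, .inl hq'⟩, ⟨ε, μ, ⟨hε, hμ⟩, .inr hq'⟩]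
    · rintro ⟨ε, μ, ⟨hε, hμ⟩, h | h⟩
      exacts [⟨_, h, ε, μ, hε, hμ, .inl rfl⟩, ⟨_, h, ε, μ, hε, hμ, .inr rfl⟩]
  rw [this]
  refine isOpen_iUnion fun ε => isOpen_iUnion fun μ => isOpen_iUnion fun _ =>
    (hV.preimage (by fun_prop)).union (hV.preimage ?_)
  have := beta.continuous
  have h2 : Continuous (starRingEnd ℂ) := Complex.continuous_conj
  fun_prop

theorem isOpenMap_aleMk (κ : Kind) : IsOpenMap (aleMk κ) := by
  intro V hV
  rw [← (isQuotientMap_aleMk κ).isOpen_preimage]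
  obtain ⟨V', hV', rfl⟩ := hV
  have h := (OrbitRel.isOpen_saturation (V := V' ∩ {q | q.2 ≠ 0})
    (hV'.inter (isOpen_compl_singleton.preimage continuous_snd))).preimage
      (continuous_subtype_val (p := fun q : ℂ × C4 => q.2 ≠ 0))
  convert h using 1
  ext q
  constructor
  · rintro ⟨q', hq', h⟩
    exact ⟨q'.1, ⟨hq', q'.2⟩, (aleMk_eq_iff κ _ _).1 h.symm⟩
  · rintro ⟨q', ⟨hq', h0⟩, h⟩
    exact ⟨⟨q', h0⟩, hq', ((aleMk_eq_iff κ _ _).2 h).symm⟩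

end LinearModel

/-! ### Tubes around the exceptional divisors -/

section Gluing

/-- Let `X` carry the topology coinduced by `f : Y → X` and the maps `g j : P → X`. If `f` and each
`g j` have open saturations, each `g j` factors through `f` on the open set `N` by a continuous open
map `h j` and avoids the range of `f` off `N`, and the ranges of the `g j` are disjoint, then all
these maps are open. -/
theorem isOpenMap_of_glued {ι Y P X : Type*} [TopologicalSpace Y] [TopologicalSpace P]
    [TopologicalSpace X] {f : Y → X} {g : ι → P → X} {N : Set P} {h : ι → N → Y}
    (hX : ∀ O : Set X, IsOpen O ↔ IsOpen (f ⁻¹' O) ∧ ∀ j, IsOpen (g j ⁻¹' O))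
    (hN : IsOpen N) (hh : ∀ j, Continuous (h j)) (hho : ∀ j, IsOpenMap (h j))
    (hf : ∀ V, IsOpen V → IsOpen (f ⁻¹' (f '' V)))
    (hgf : ∀ j (q : N), g j q = f (h j q)) (hgN : ∀ j q, q ∉ N → g j q ∉ range f)
    (hg : ∀ j V, IsOpen V → IsOpen (g j ⁻¹' (g j '' V)))
    (hij : ∀ i j q q', g i q = g j q' → i = j) :
    IsOpenMap f ∧ ∀ j, IsOpenMap (g j) := by
  refine ⟨fun V hV => (hX _).2 ⟨hf V hV, fun j => ?_⟩, fun j V hV => (hX _).2 ⟨?_, fun i => ?_⟩⟩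
  · have : g j ⁻¹' (f '' V) = Subtype.val '' (h j ⁻¹' (f ⁻¹' (f '' V))) := by
      ext q
      constructor
      · intro hq
        by_cases hqN : q ∈ N
        · exact ⟨⟨q, hqN⟩, by rw [mem_preimage, mem_preimage, ← hgf]; exact hq, rfl⟩
        · obtain ⟨y, -, hy⟩ := hq
          exact (hgN j q hqN ⟨y, hy⟩).elim
      · rintro ⟨q, hq, rfl⟩
        rw [mem_preimage, hgf]
        exact hq
    rw [this]
    exact hN.isOpenMap_subtype_val _ ((hf V hV).preimage (hh j))
  · have : f ⁻¹' (g j '' V) = f ⁻¹' (f '' (h j '' (Subtype.val ⁻¹' V))) := by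
      ext y
      constructor
      · rintro ⟨q, hq, hqy⟩
        by_cases hqN : q ∈ N
        · exact ⟨_, ⟨⟨q, hqN⟩, hq, rfl⟩, by rw [← hgf]; exact hqy⟩
        · exact (hgN j q hqN ⟨y, hqy.symm⟩).elim
      · rintro ⟨_, ⟨q, hq, rfl⟩, hy⟩
        exact ⟨q, hq, by rw [hgf, hy]⟩
    rw [this]
    exact hf _ (hho j _ (hV.preimage continuous_subtype_val))
  · by_cases h : i = j
    · subst h
      exact hg i V hV
    · convert isOpen_empty
      ext q
      simp only [mem_preimage, mem_image, mem_empty_iff_false, iff_false]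
      rintro ⟨q', -, hq'⟩
      exact h (hij j i q' q hq').symm

/-- The hypotheses on the orbifold, its charts and the parameter `t`, gathered in one
proposition. -/
structure DesingData {Y : Type*} [TopologicalSpace Y] (A : ComplexOrbifold Y) (σ : Y → Y) {k : ℕ}
    (p : Fin k → Y) (ζ : ℝ) (c : Fin k → OrbifoldChart Y) (t : ℝ) : Prop where
  adm : A.Admissible σ p
  pos : 0 < ζ
  chart : ∀ j, IsResolutionChart A σ (p j) ζ (c j)
  disj : ∀ i j, i ≠ j → Disjoint (chartImage σ ζ (c i)) (chartImage σ ζ (c j))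
  mem : t ∈ Set.Ioc (0 : ℝ) 1

/-- Homogeneous coordinates `(a, w)` on the part `‖a w‖ < R` of the blow-up, a disc bundle over the
exceptional divisor `a = 0`. -/
abbrev Tube (R : ℝ) : Type := {q : ℂ × C4 // q.2 ≠ 0 ∧ ‖q.1 • q.2‖ < R}

/-- The inclusion of the tube into the homogeneous coordinates on the whole blow-up. -/
def Tube.toHom {R : ℝ} (q : Tube R) : Hom4 := ⟨q.1, q.2.1⟩

theorem Tube.isOpenEmbedding_toHom (R : ℝ) : IsOpenEmbedding (Tube.toHom (R := R)) := by
  refine .of_continuous_injective_isOpenMap (by unfold Tube.toHom; fun_prop) ?_ ?_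
  · intro a b h
    exact Subtype.ext (congrArg (fun x : Hom4 => x.1) h)
  · rintro _ ⟨V, hV, rfl⟩
    refine ⟨V ∩ {q | ‖q.1 • q.2‖ < R}, hV.inter (isOpen_lt (by fun_prop) continuous_const), ?_⟩
    ext q
    constructor
    · rintro ⟨h1, h2⟩
      exact ⟨⟨q.1, q.2, h2⟩, h1, rfl⟩
    · rintro ⟨q, hq, rfl⟩
      exact ⟨hq, q.2.2⟩

/-- The point `t a w` of `ℝ⁸`, with `a w` read in the coordinates `κ.coord`; its class modulo `G` is
the image under `t π` of the point with homogeneous coordinates `(a, w)`. -/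
noncomputable def tubePoint (κ : Kind) (t : ℝ) {R : ℝ} (q : Tube R) : C4 :=
  t • κ.coord.symm (q.1.1 • q.1.2)

theorem continuous_tubePoint (κ : Kind) (t R : ℝ) :
    Continuous (tubePoint κ t : Tube R → C4) := by
  have := κ.coord.symm.continuous
  unfold tubePoint
  fun_prop

theorem isOpen_image_tubePoint (κ : Kind) {t R : ℝ} (ht : t ≠ 0) {V : Set (Tube R)}
    (hV : IsOpen V) : IsOpen (tubePoint κ t '' {q ∈ V | q.1.1 ≠ 0}) := by
  obtain ⟨V, hV, rfl⟩ := hV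
  have : tubePoint κ t '' {q : Tube R | q ∈ Subtype.val ⁻¹' V ∧ q.1.1 ≠ 0} =
      (fun v : C4 => t • v) '' (κ.coord.symm '' ⋃ (a : ℂ) (_ : a ≠ 0), (fun w : C4 => a • w) ''
        ((fun w => (a, w)) ⁻¹' V ∩ ({0}ᶜ ∩ {w | ‖a • w‖ < R}))) := by
    ext v
    simp only [mem_image, mem_iUnion]
    constructor
    · rintro ⟨q, ⟨hq, h0⟩, rfl⟩
      exact ⟨_, ⟨_, ⟨q.1.1, h0, q.1.2, ⟨hq, q.2⟩, rfl⟩, rfl⟩, rfl⟩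
    · rintro ⟨_, ⟨_, ⟨a, ha, w, ⟨h1, h2⟩, rfl⟩, rfl⟩, rfl⟩
      exact ⟨⟨(a, w), h2⟩, ⟨h1, ha⟩, rfl⟩
  rw [this]
  refine isOpenMap_smul₀ ht _ (κ.coord.symm.toHomeomorph.isOpenMap _ ?_)
  refine isOpen_iUnion fun a => isOpen_iUnion fun ha => isOpenMap_smul₀ ha _ ?_
  exact (hV.preimage (by fun_prop)).inter
    (isOpen_compl_singleton.inter (isOpen_lt (by fun_prop) continuous_const))

theorem Cone.mk_eq_iff {v w : C4} : Cone.mk v = Cone.mk w ↔ ∃ g ∈ G, g v = w :=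
  Quotient.eq (r := coneSetoid)

theorem Cone.mk_eq_mk_zero {v : C4} : Cone.mk v = Cone.mk 0 ↔ v = 0 := by
  rw [Cone.mk_eq_iff]
  constructor
  · rintro ⟨g, -, h⟩
    simpa using h
  · rintro rfl
    exact ⟨1, G.one_mem, by simp⟩

theorem cone_mk_beta (v : C4) : Cone.mk (beta v) = Cone.mk v :=
  (Cone.mk_eq_iff.2 ⟨beta, Subgroup.subset_closure (by simp), rfl⟩).symm

theorem tubePoint_eq_zero_iff {κ : Kind} {t R : ℝ} (ht : t ≠ 0) (q : Tube R) :
    tubePoint κ t q = 0 ↔ q.1.1 = 0 := by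
  simp [tubePoint, ht, q.2.1]

theorem norm_tubePoint (κ : Kind) {t R : ℝ} (ht : 0 < t) (q : Tube R) :
    ‖tubePoint κ t q‖ = t * ‖q.1.1 • q.1.2‖ := by
  rw [tubePoint, norm_smul, LinearIsometryEquiv.norm_map, Real.norm_of_nonneg ht.le]

theorem cone_mk_tubePoint_eq_iff (κ : Kind) {t R : ℝ} (ht : t ≠ 0) {q q' : Tube R}
    (hq : q.1.1 ≠ 0) :
    Cone.mk (tubePoint κ t q) = Cone.mk (tubePoint κ t q') ↔ OrbitRel q.1 q'.1 := by
  constructor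
  · intro h
    have hq' : q'.1.1 ≠ 0 := by
      rintro h0
      rw [(tubePoint_eq_zero_iff ht q').2 h0, Cone.mk_eq_mk_zero] at h
      exact hq ((tubePoint_eq_zero_iff ht q).1 h)
    obtain ⟨g, hg, h⟩ := Cone.mk_eq_iff.1 h
    unfold tubePoint at h
    rw [g.map_smul] at h
    have h1 := congrArg κ.coord (smul_right_injective C4 ht h)
    clear h
    obtain ⟨⟨l, w⟩, hw, _⟩ := q
    obtain ⟨⟨l', w'⟩, hw', _⟩ := q'
    dsimp only at hq hq' h1 hw hw' ⊢
    obtain ⟨ε, hε, h2⟩ := coord_mem_G κ hg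
    have hε0 : ε ≠ 0 := by rintro rfl; simp at hε
    rcases h2 with h2 | h2
    · rw [h2, LinearIsometryEquiv.apply_symm_apply, LinearIsometryEquiv.apply_symm_apply,
        ← inv_smul_eq_iff₀ hq', smul_smul, smul_smul] at h1
      refine ⟨ε, _, hε, ?_, .inl (Prod.ext ?_ h1.symm)⟩
      · positivity
      · field_simp
    · rw [h2, LinearIsometryEquiv.apply_symm_apply, LinearIsometryEquiv.apply_symm_apply,
        beta_smul, ← inv_smul_eq_iff₀ hq', smul_smul, smul_smul] at h1
      have hc : starRingEnd ℂ l ≠ 0 := by simpa using hq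
      refine ⟨ε, _, hε, ?_, .inr (Prod.ext ?_ h1.symm)⟩
      · positivity
      · simp only
        field_simp
  · intro h
    exact congrArg (ALE.projScaled t) ((aleMk_eq_iff κ q.toHom q'.toHom).2 h)

end Gluing

/-! ### The orbifold charts and the involution -/

namespace DesingData

variable {Y : Type*} [TopologicalSpace Y] {A : ComplexOrbifold Y} {σ : Y → Y} {k : ℕ}
  {p : Fin k → Y} {ζ : ℝ} {c : Fin k → OrbifoldChart Y} {t : ℝ}

/-- The points of `Z` are the pairs `{y, σ y}`. -/
theorem mk_eq_iff (S : DesingData A σ p ζ c t) {y z : Y} :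
    OrbitSpace.mk σ y = OrbitSpace.mk σ z ↔ z = y ∨ z = σ y := by
  constructor
  · intro h
    let F : OrbitSpace σ → Set Y := Quot.lift (fun y => {y, σ y}) (by
      rintro y _ rfl
      rw [S.adm.involutive y, pair_comm])
    have h1 : ({y, σ y} : Set Y) = {z, σ z} := congrArg F h
    have : z ∈ ({y, σ y} : Set Y) := h1 ▸ mem_insert _ _
    exact this
  · rintro (rfl | rfl)
    · rfl
    · exact Quot.sound rfl

theorem continuous_mk (σ : Y → Y) : Continuous (OrbitSpace.mk σ) := continuous_quot_mk

theorem isQuotientMap_mk (σ : Y → Y) : IsQuotientMap (OrbitSpace.mk σ) := isQuotientMap_quot_mk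

theorem isOpenMap_mk (S : DesingData A σ p ζ c t) : IsOpenMap (OrbitSpace.mk σ) := by
  intro V hV
  rw [← (isQuotientMap_mk σ).isOpen_preimage]
  have : OrbitSpace.mk σ ⁻¹' (OrbitSpace.mk σ '' V) = V ∪ σ ⁻¹' V := by
    ext y
    simp only [mem_preimage, mem_image, mem_union, S.mk_eq_iff]
    constructor
    · rintro ⟨z, hz, rfl | rfl⟩
      · exact .inl hz
      · right
        rwa [S.adm.involutive z]
    · rintro (h | h)
      exacts [⟨y, h, .inl rfl⟩, ⟨σ y, h, .inr (S.adm.involutive y).symm⟩]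
  rw [this]
  exact hV.union (hV.preimage S.adm.continuous)

theorem mem_dom (S : DesingData A σ p ζ c t) (j : Fin k) {v : C4} (hv : ‖v‖ < 2 * ζ) :
    v ∈ (c j).dom := by
  rw [(S.chart j).dom_eq]
  simpa using hv

theorem descends_iff (S : DesingData A σ p ζ c t) (j : Fin k) {v w : C4} (hv : ‖v‖ < 2 * ζ)
    (hw : ‖w‖ < 2 * ζ) :
    OrbitSpace.mk σ ((c j).toFun v) = OrbitSpace.mk σ ((c j).toFun w) ↔ Cone.mk v = Cone.mk w :=
  (S.chart j).descends v (by simpa using hv) w (by simpa using hw)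

theorem mem_chartImage (S : DesingData A σ p ζ c t) (j : Fin k) {v : C4} (hv : ‖v‖ < 2 * ζ) :
    OrbitSpace.mk σ ((c j).toFun v) ∈ chartImage σ ζ (c j) :=
  ⟨Cone.mk v, hv, psi_mk (S.chart j) hv⟩

/-- The charts at different singular points have disjoint images in `Z`. -/
theorem index_eq (S : DesingData A σ p ζ c t) {i j : Fin k} {v w : C4} (hv : ‖v‖ < 2 * ζ)
    (hw : ‖w‖ < 2 * ζ)
    (h : OrbitSpace.mk σ ((c i).toFun v) = OrbitSpace.mk σ ((c j).toFun w)) : i = j := by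
  by_contra hij
  exact (S.disj i j hij).le_bot ⟨S.mem_chartImage i hv, h ▸ S.mem_chartImage j hw⟩

theorem chart_eq_iff (S : DesingData A σ p ζ c t) (j : Fin k) {v w : C4} (hv : ‖v‖ < 2 * ζ)
    (hw : ‖w‖ < 2 * ζ) :
    (c j).toFun v = (c j).toFun w ↔ ∃ ε : ℂ, ε ^ 4 = 1 ∧ w = ε • v := by
  rw [(c j).eq_iff v (S.mem_dom j hv) w (S.mem_dom j hw), (S.chart j).group_eq]
  have hpow : ∀ (m : ℕ) (v : C4), (alphaC ^ m) v = Complex.I ^ m • v := by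
    intro m
    induction m with
    | zero => simp
    | succ m ih =>
      intro v
      rw [pow_succ', LinearEquiv.mul_apply, ih, pow_succ', mul_smul]
      rfl
  have h4 : alphaC ^ (4 : ℤ) = 1 := by
    ext v : 1
    rw [zpow_ofNat]
    change (alphaC ^ 4) v = v
    rw [hpow, Complex.I_pow_four, one_smul]
  constructor
  · rintro ⟨g, ⟨m, rfl⟩, rfl⟩
    obtain ⟨r, hr⟩ := Int.eq_ofNat_of_zero_le (Int.emod_nonneg m (by norm_num : (4 : ℤ) ≠ 0))
    have hm : alphaC ^ m = alphaC ^ r := by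
      conv_lhs => rw [← Int.emod_add_mul_ediv m 4, zpow_add, zpow_mul, h4, one_zpow, mul_one, hr,
        zpow_natCast]
    refine ⟨Complex.I ^ r, ?_, ?_⟩
    · rw [← pow_mul, mul_comm, pow_mul, Complex.I_pow_four, one_pow]
    · change (alphaC ^ m) v = _
      rw [hm, hpow]
  · rintro ⟨ε, hε, rfl⟩
    obtain ⟨m, rfl⟩ := exists_eq_I_pow hε
    exact ⟨alphaC ^ m, ⟨m, by simp⟩, hpow m v⟩

theorem chart_zero (S : DesingData A σ p ζ c t) (j : Fin k) : (c j).toFun 0 = p j :=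
  (S.chart j).map_zero

theorem norm_zero_lt (S : DesingData A σ p ζ c t) : ‖(0 : C4)‖ < 2 * ζ := by
  have := S.pos
  simp [this]

theorem apply_eq_self_iff (S : DesingData A σ p ζ c t) {y : Y} : σ y = y ↔ y ∈ range p := by
  rw [← S.adm.fixedPoints_eq]
  rfl

/-- Apart from its centre, a chart does not meet the singular points. -/
theorem chart_notMem (S : DesingData A σ p ζ c t) (j : Fin k) {v : C4} (hv : ‖v‖ < 2 * ζ)
    (h0 : v ≠ 0) : (c j).toFun v ∈ (range p)ᶜ := by
  rintro ⟨i, hi⟩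
  rw [← S.chart_zero i] at hi
  obtain rfl := S.index_eq S.norm_zero_lt hv (congrArg _ hi)
  obtain ⟨ε, -, h⟩ := (S.chart_eq_iff i S.norm_zero_lt hv).1 hi
  simp [h0] at h

/-- The chart intertwines `β` with `σ`. As `β` is trivial in `ℝ⁸ / G`, the point `c (β v)` is `c v`
or `σ (c v)`; it is not `c v`, because `β v` is orthogonal to `v` and so not a multiple of it. -/
theorem chart_beta (S : DesingData A σ p ζ c t) (j : Fin k) {v : C4} (hv : ‖v‖ < 2 * ζ)
    (h0 : v ≠ 0) : (c j).toFun (beta v) = σ ((c j).toFun v) := by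
  have hv' : ‖beta v‖ < 2 * ζ := by rwa [LinearIsometryEquiv.norm_map]
  rcases S.mk_eq_iff.1 ((S.descends_iff j hv hv').2 (cone_mk_beta v).symm) with h | h
  · obtain ⟨ε, hε, h1⟩ := (S.chart_eq_iff j hv hv').1 h.symm
    have h2 := inner_beta_self v
    rw [h1, inner_smul_right] at h2
    rcases mul_eq_zero.1 h2 with h2 | h2
    · simp [h2] at hε
    · exact (h0 (inner_self_eq_zero.1 h2)).elim
  · exact h

theorem compl_mem (S : DesingData A σ p ζ c t) {y : Y} (hy : y ∈ (range p)ᶜ) :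
    σ y ∈ (range p)ᶜ := by
  intro h
  have := S.apply_eq_self_iff.2 h
  rw [S.adm.involutive y] at this
  exact hy (S.apply_eq_self_iff.1 this.symm)

theorem rpow_pos (S : DesingData A σ p ζ c t) : 0 < t ^ (4 / 5 : ℝ) :=
  Real.rpow_pos_of_pos S.mem.1 _

theorem rpow_le_one (S : DesingData A σ p ζ c t) : t ^ (4 / 5 : ℝ) ≤ 1 :=
  Real.rpow_le_one S.mem.1.le S.mem.2 (by norm_num)

end DesingData

/-! ### The desingularization as a union of the regular part and tubes -/

/-- The radius of the tube in `X` which `t π` maps onto the ball of radius `2 t^(4/5) ζ`. -/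
noncomputable def tubeRadius (ζ t : ℝ) : ℝ := 2 * t ^ (4 / 5 : ℝ) * ζ / t

namespace DesingData

variable {Y : Type*} [TopologicalSpace Y] {A : ComplexOrbifold Y} {σ : Y → Y} {k : ℕ}
  {p : Fin k → Y} {ζ : ℝ} {c : Fin k → OrbifoldChart Y} {t : ℝ}

theorem norm_tubePoint_lt (S : DesingData A σ p ζ c t) (κ : Kind) (q : Tube (tubeRadius ζ t)) :
    ‖tubePoint κ t q‖ < 2 * t ^ (4 / 5 : ℝ) * ζ := by
  rw [norm_tubePoint κ S.mem.1, mul_comm, ← lt_div_iff₀ S.mem.1]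
  exact q.2.2

theorem two_mul_le (S : DesingData A σ p ζ c t) : 2 * t ^ (4 / 5 : ℝ) * ζ ≤ 2 * ζ := by
  have := S.rpow_le_one
  have := S.pos
  nlinarith

theorem norm_tubePoint_lt_dom (S : DesingData A σ p ζ c t) (κ : Kind) (q : Tube (tubeRadius ζ t)) :
    ‖tubePoint κ t q‖ < 2 * ζ := (S.norm_tubePoint_lt κ q).trans_le S.two_mul_le

theorem lt_two_mul_of_le (S : DesingData A σ p ζ c t) {r : ℝ} (hr : r ≤ t ^ (4 / 5 : ℝ) * ζ) :
    r < 2 * t ^ (4 / 5 : ℝ) * ζ := by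
  have := mul_pos S.rpow_pos S.pos
  linarith

theorem mem_outerPiece_iff (S : DesingData A σ p ζ c t) {z : OrbitSpace σ} :
    z ∈ outerPiece σ ζ c t ↔
      ∀ j v, ‖v‖ ≤ t ^ (4 / 5 : ℝ) * ζ → OrbitSpace.mk σ ((c j).toFun v) ≠ z := by
  simp only [outerPiece, mem_compl_iff, mem_iUnion, not_exists]
  refine forall_congr' fun j => ⟨fun h v hv hz => h ⟨Cone.mk v, hv, ?_⟩, ?_⟩
  · rw [psi_mk (S.chart j) ((S.lt_two_mul_of_le hv).trans_le S.two_mul_le)]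
    exact hz
  · rintro h ⟨x, hx, hz⟩
    exact h (Quotient.out x) (le_of_eq_of_le (congrArg Cone.radius (Quotient.out_eq x)) hx) hz

theorem isOpen_outerPiece [T2Space Y] (S : DesingData A σ p ζ c t) :
    IsOpen (outerPiece σ ζ c t) := by
  rw [← (isQuotientMap_mk σ).isOpen_preimage]
  have : OrbitSpace.mk σ ⁻¹' outerPiece σ ζ c t =
      (⋃ j, ((c j).toFun '' closedBall 0 (t ^ (4 / 5 : ℝ) * ζ) ∪
        σ ⁻¹' ((c j).toFun '' closedBall 0 (t ^ (4 / 5 : ℝ) * ζ))))ᶜ := by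
    ext y
    rw [mem_preimage, S.mem_outerPiece_iff]
    simp only [ne_eq, S.mk_eq_iff, mem_compl_iff, mem_iUnion, mem_union, mem_preimage, mem_image,
      mem_closedBall, dist_zero_right, not_exists, not_or, not_and]
    refine forall_congr' fun j => ⟨fun h => ⟨fun v hv hy => (h v hv).1 hy.symm, fun v hv hy =>
      (h v hv).2 ?_⟩, fun h v hv => ⟨fun hy => h.1 v hv hy.symm, fun hy => h.2 v hv ?_⟩⟩
    · rw [hy, S.adm.involutive]
    · rw [hy, S.adm.involutive]
  rw [this, isOpen_compl_iff]
  have hcl : ∀ j, IsClosed ((c j).toFun '' closedBall 0 (t ^ (4 / 5 : ℝ) * ζ)) := fun j =>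
    ((isCompact_closedBall _ _).image_of_continuousOn ((c j).continuousOn.mono fun v hv =>
      S.mem_dom j ((S.lt_two_mul_of_le (by simpa using hv)).trans_le S.two_mul_le))).isClosed
  exact isClosed_iUnion_of_finite fun j => (hcl j).union ((hcl j).preimage S.adm.continuous)

theorem isOpen_compl [T2Space Y] (_ : DesingData A σ p ζ c t) : IsOpen (range p)ᶜ :=
  (finite_range p).isClosed.isOpen_compl

variable (n : Fin k → Kind)

/-- The point of `Mⱼᵗ` with given homogeneous coordinates. -/
noncomputable def innerMk (S : DesingData A σ p ζ c t) (j : Fin k) (q : Tube (tubeRadius ζ t)) :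
    innerPiece ζ t (n j) :=
  ⟨aleMk (n j) q.toHom, S.norm_tubePoint_lt (n j) q⟩

/-- The point of `Mᵗ` given by homogeneous coordinates in the tube around the `j`-th exceptional
divisor. -/
noncomputable def tubeMap (S : DesingData A σ p ζ c t) (j : Fin k) (q : Tube (tubeRadius ζ t)) :
    Resolution σ ζ c n t :=
  Quot.mk _ (Sum.inr ⟨j, S.innerMk n j q⟩)

/-- The regular point of `Y` over which the point of the tube with homogeneous coordinates
`(a, w)`, `a ≠ 0`, lies: the value of the chart at `t a w`. -/
noncomputable def tubeChart (S : DesingData A σ p ζ c t) (j : Fin k)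
    (q : {q : Tube (tubeRadius ζ t) | q.1.1 ≠ 0}) : ((range p)ᶜ : Set Y) :=
  ⟨(c j).toFun (tubePoint (n j) t q.1), S.chart_notMem j (S.norm_tubePoint_lt_dom _ _)
    fun h => q.2 ((tubePoint_eq_zero_iff S.mem.1.ne' _).1 h)⟩

theorem innerMk_surjective (S : DesingData A σ p ζ c t) (j : Fin k) :
    Function.Surjective (S.innerMk n j) := by
  rintro ⟨x, hx⟩
  obtain ⟨q, rfl⟩ := aleMk_surjective (n j) x
  refine ⟨⟨q.1, q.2, ?_⟩, rfl⟩
  have h : ‖t • (n j).coord.symm (q.1.1 • q.1.2)‖ < 2 * t ^ (4 / 5 : ℝ) * ζ := hx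
  rw [norm_smul, LinearIsometryEquiv.norm_map, Real.norm_of_nonneg S.mem.1.le, mul_comm,
    ← lt_div_iff₀ S.mem.1] at h
  exact h

open Classical in
/-- A description of `Mᵗ` without gluing: a point is sent to its image in `Z` if it lies off the
exceptional divisors, and otherwise to itself as a point of `Xⱼ`. This map is injective
(`normalForm_injective`), so it detects equality in the glued space. -/
noncomputable def normalForm (S : DesingData A σ p ζ c t) :
    Resolution σ ζ c n t → OrbitSpace σ ⊕ Σ j, ALE (n j) :=
  Quot.lift (fun x => match x with
    | .inl z => .inl z.1
    | .inr ⟨j, x⟩ =>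
      if x.1.proj = Cone.mk 0 then .inr ⟨j, x.1⟩ else .inl (psi σ (c j) (x.1.projScaled t))) (by
    rintro _ _ ⟨j, x, z, h⟩
    have : x.1.proj ≠ Cone.mk 0 := by
      intro h0
      have h1 : x.1.projScaled t = Cone.mk 0 := by
        rw [ALE.projScaled, h0]
        exact congrArg Cone.mk (smul_zero t)
      rw [h1, psi_mk (S.chart j) S.norm_zero_lt] at h
      exact S.mem_outerPiece_iff.1 z.2 j 0 (by
        rw [norm_zero]; exact (mul_pos S.rpow_pos S.pos).le) h
    simp only [this, if_false, h])

theorem normalForm_inl (S : DesingData A σ p ζ c t) (z : outerPiece σ ζ c t) :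
    S.normalForm n (Quot.mk _ (Sum.inl z)) = .inl z.1 := rfl

theorem normalForm_tubeMap_zero (S : DesingData A σ p ζ c t) (j : Fin k)
    (q : Tube (tubeRadius ζ t)) (hq : q.1.1 = 0) :
    S.normalForm n (S.tubeMap n j q) = .inr ⟨j, aleMk (n j) q.toHom⟩ := by
  have : (aleMk (n j) q.toHom).proj = Cone.mk 0 := by
    change Cone.mk ((n j).coord.symm (q.1.1 • q.1.2)) = _
    rw [hq, zero_smul, map_zero]
  exact if_pos this

theorem normalForm_tubeMap (S : DesingData A σ p ζ c t) (j : Fin k)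
    (q : Tube (tubeRadius ζ t)) (hq : q.1.1 ≠ 0) :
    S.normalForm n (S.tubeMap n j q) =
      .inl (OrbitSpace.mk σ ((c j).toFun (tubePoint (n j) t q))) := by
  have : (aleMk (n j) q.toHom).proj ≠ Cone.mk 0 := by
    change Cone.mk ((n j).coord.symm (q.1.1 • q.1.2)) ≠ _
    rw [Ne, Cone.mk_eq_mk_zero]
    simp [hq, q.2.1]
  rw [← psi_mk (S.chart j) (S.norm_tubePoint_lt_dom _ _)]
  exact if_neg this

theorem tubeMap_eq_of_orbitRel (S : DesingData A σ p ζ c t) {j : Fin k}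
    {q q' : Tube (tubeRadius ζ t)} (h : OrbitRel q.1 q'.1) :
    S.tubeMap n j q = S.tubeMap n j q' := by
  have : S.innerMk n j q = S.innerMk n j q' :=
    Subtype.ext ((aleMk_eq_iff (n j) q.toHom q'.toHom).2 h)
  rw [tubeMap, tubeMap, this]

theorem tubeMap_surj (S : DesingData A σ p ζ c t) (m : Resolution σ ζ c n t) :
    (∃ z, m = Quot.mk _ (Sum.inl z)) ∨ ∃ j q, m = S.tubeMap n j q := by
  induction m using Quot.ind with | mk x
  rcases x with z | ⟨j, x⟩
  · exact .inl ⟨z, rfl⟩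
  · obtain ⟨q, rfl⟩ := S.innerMk_surjective n j x
    exact .inr ⟨j, q, rfl⟩

theorem inl_eq_tubeMap (S : DesingData A σ p ζ c t) (z : outerPiece σ ζ c t) (j : Fin k)
    (q : Tube (tubeRadius ζ t))
    (h : OrbitSpace.mk σ ((c j).toFun (tubePoint (n j) t q)) = z.1) :
    (Quot.mk _ (Sum.inl z) : Resolution σ ζ c n t) = S.tubeMap n j q := by
  refine Quot.sound (GlueRel.glue j _ z ?_)
  rw [← h, ← psi_mk (S.chart j) (S.norm_tubePoint_lt_dom _ _)]
  rfl

theorem normalForm_injective (S : DesingData A σ p ζ c t) :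
    Function.Injective (S.normalForm n) := by
  have key : ∀ (z : outerPiece σ ζ c t) (j : Fin k) (q : Tube (tubeRadius ζ t)),
      S.normalForm n (Quot.mk _ (Sum.inl z)) = S.normalForm n (S.tubeMap n j q) →
      (Quot.mk _ (Sum.inl z) : Resolution σ ζ c n t) = S.tubeMap n j q := by
    intro z j q h
    rw [normalForm_inl] at h
    by_cases hq : q.1.1 = 0
    · rw [S.normalForm_tubeMap_zero n j q hq] at h
      cases h
    · rw [S.normalForm_tubeMap n j q hq] at h
      exact S.inl_eq_tubeMap n z j q (Sum.inl_injective h).symm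
  intro m m' h
  rcases S.tubeMap_surj n m with ⟨z, rfl⟩ | ⟨j, q, rfl⟩ <;>
    rcases S.tubeMap_surj n m' with ⟨z', rfl⟩ | ⟨j', q', rfl⟩
  · have := Subtype.ext (Sum.inl_injective h)
    rw [this]
  · exact key z j' q' h
  · exact (key z' j q h.symm).symm
  · by_cases hq : q.1.1 = 0 <;> by_cases hq' : q'.1.1 = 0
    · rw [S.normalForm_tubeMap_zero n j q hq, S.normalForm_tubeMap_zero n j' q' hq'] at h
      have h1 := Sum.inr_injective h
      obtain rfl : j = j' := congrArg Sigma.fst h1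
      exact S.tubeMap_eq_of_orbitRel n
        ((aleMk_eq_iff (n j) q.toHom q'.toHom).1 (eq_of_heq (Sigma.mk.inj h1).2))
    · rw [S.normalForm_tubeMap_zero n j q hq, S.normalForm_tubeMap n j' q' hq'] at h
      cases h
    · rw [S.normalForm_tubeMap n j q hq, S.normalForm_tubeMap_zero n j' q' hq'] at h
      cases h
    · rw [S.normalForm_tubeMap n j q hq, S.normalForm_tubeMap n j' q' hq'] at h
      have h1 := Sum.inl_injective h
      obtain rfl := S.index_eq (S.norm_tubePoint_lt_dom _ _) (S.norm_tubePoint_lt_dom _ _) h1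
      rw [S.descends_iff j (S.norm_tubePoint_lt_dom _ _) (S.norm_tubePoint_lt_dom _ _)] at h1
      exact S.tubeMap_eq_of_orbitRel n ((cone_mk_tubePoint_eq_iff _ S.mem.1.ne' hq).1 h1)

/-- Each regular point of `Z` comes from `Mᵗ`: it lies in `M₀ᵗ` or is the value of a chart at a
point of norm at most `t^(4/5) ζ`, which is less than `2 t^(4/5) ζ`. -/
theorem exists_normalForm_eq (S : DesingData A σ p ζ c t) (y : ((range p)ᶜ : Set Y)) :
    ∃ m, S.normalForm n m = .inl (OrbitSpace.mk σ y) := by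
  by_cases h : OrbitSpace.mk σ (y : Y) ∈ outerPiece σ ζ c t
  · exact ⟨Quot.mk _ (Sum.inl ⟨_, h⟩), rfl⟩
  · rw [S.mem_outerPiece_iff] at h
    push Not at h
    obtain ⟨j, v, hv, h⟩ := h
    have hv0 : v ≠ 0 := by
      rintro rfl
      rw [S.chart_zero, S.mk_eq_iff, S.apply_eq_self_iff.2 (mem_range_self j), or_self] at h
      exact y.2 (h ▸ mem_range_self j)
    have ht := S.mem.1
    let w := (n j).coord v
    have hw0 : w ≠ 0 := by simpa [w] using hv0
    let q : Tube (tubeRadius ζ t) := ⟨((t⁻¹ : ℂ), w), hw0, by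
      have h1 : ‖w‖ = ‖v‖ := LinearIsometryEquiv.norm_map _ _
      rw [norm_smul, h1, tubeRadius, lt_div_iff₀ ht]
      simp only [norm_inv, Complex.norm_real, Real.norm_of_nonneg ht.le]
      have := S.lt_two_mul_of_le hv
      field_simp
      linarith⟩
    have hq : tubePoint (n j) t q = v := by
      have h1 : (t⁻¹ : ℂ) • w = (t⁻¹ : ℝ) • w := by
        rw [← Complex.ofReal_inv, Complex.coe_smul]
      rw [tubePoint]
      simp only [q]
      rw [h1, map_smul, LinearIsometryEquiv.symm_apply_apply, smul_smul,
        mul_inv_cancel₀ ht.ne', one_smul]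
    refine ⟨S.tubeMap n j q, ?_⟩
    rw [S.normalForm_tubeMap n j q (by simpa [q] using ht.ne'), hq, h]

/-- The map from the regular part of `Y` to `Mᵗ`, which identifies `Mᵗ` without the exceptional
divisors with the quotient of the regular part of `Y` by `σ`. -/
noncomputable def outerMap (S : DesingData A σ p ζ c t) (y : ((range p)ᶜ : Set Y)) :
    Resolution σ ζ c n t :=
  (S.exists_normalForm_eq n y).choose

theorem normalForm_outerMap (S : DesingData A σ p ζ c t) (y : ((range p)ᶜ : Set Y)) :
    S.normalForm n (S.outerMap n y) = .inl (OrbitSpace.mk σ y) :=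
  (S.exists_normalForm_eq n y).choose_spec

theorem outerMap_eq_iff (S : DesingData A σ p ζ c t) {y y' : ((range p)ᶜ : Set Y)} :
    S.outerMap n y = S.outerMap n y' ↔ y'.1 = y.1 ∨ y'.1 = σ y := by
  rw [← (S.normalForm_injective n).eq_iff, normalForm_outerMap, normalForm_outerMap,
    Sum.inl_injective.eq_iff, S.mk_eq_iff]

theorem tubeMap_eq_outerMap (S : DesingData A σ p ζ c t) (j : Fin k)
    (q : {q : Tube (tubeRadius ζ t) | q.1.1 ≠ 0}) :
    S.tubeMap n j q = S.outerMap n (S.tubeChart n j q) := by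
  apply S.normalForm_injective n
  rw [normalForm_outerMap, S.normalForm_tubeMap n j q q.2]
  rfl

/-- The exceptional divisors are disjoint from the image of the regular part. -/
theorem tubeMap_notMem_range (S : DesingData A σ p ζ c t) (j : Fin k)
    (q : Tube (tubeRadius ζ t)) (hq : q.1.1 = 0) : S.tubeMap n j q ∉ range (S.outerMap n) := by
  rintro ⟨y, hy⟩
  have := congrArg (S.normalForm n) hy
  rw [normalForm_outerMap, S.normalForm_tubeMap_zero n j q hq] at this
  cases this

theorem tubeMap_eq_iff (S : DesingData A σ p ζ c t) {j : Fin k} {q q' : Tube (tubeRadius ζ t)} :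
    S.tubeMap n j q = S.tubeMap n j q' ↔ OrbitRel q.1 q'.1 := by
  refine ⟨fun h => ?_, S.tubeMap_eq_of_orbitRel n⟩
  have h := congrArg (S.normalForm n) h
  by_cases hq : q.1.1 = 0 <;> by_cases hq' : q'.1.1 = 0
  · rw [S.normalForm_tubeMap_zero n j q hq, S.normalForm_tubeMap_zero n j q' hq'] at h
    exact (aleMk_eq_iff (n j) q.toHom q'.toHom).1
      (eq_of_heq (Sigma.mk.inj (Sum.inr_injective h)).2)
  · rw [S.normalForm_tubeMap_zero n j q hq, S.normalForm_tubeMap n j q' hq'] at h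
    cases h
  · rw [S.normalForm_tubeMap n j q hq, S.normalForm_tubeMap_zero n j q' hq'] at h
    cases h
  · rw [S.normalForm_tubeMap n j q hq, S.normalForm_tubeMap n j q' hq'] at h
    have h1 := Sum.inl_injective h
    rw [S.descends_iff j (S.norm_tubePoint_lt_dom _ _) (S.norm_tubePoint_lt_dom _ _)] at h1
    exact (cone_mk_tubePoint_eq_iff _ S.mem.1.ne' hq).1 h1

/-- The tubes around different exceptional divisors are disjoint. -/
theorem tubeMap_index (S : DesingData A σ p ζ c t) {i j : Fin k} {q q' : Tube (tubeRadius ζ t)}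
    (h : S.tubeMap n i q = S.tubeMap n j q') : i = j := by
  have h := congrArg (S.normalForm n) h
  by_cases hq : q.1.1 = 0 <;> by_cases hq' : q'.1.1 = 0
  · rw [S.normalForm_tubeMap_zero n i q hq, S.normalForm_tubeMap_zero n j q' hq'] at h
    exact congrArg Sigma.fst (Sum.inr_injective h)
  · rw [S.normalForm_tubeMap_zero n i q hq, S.normalForm_tubeMap n j q' hq'] at h
    cases h
  · rw [S.normalForm_tubeMap n i q hq, S.normalForm_tubeMap_zero n j q' hq'] at h
    cases h
  · rw [S.normalForm_tubeMap n i q hq, S.normalForm_tubeMap n j q' hq'] at h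
    exact S.index_eq (S.norm_tubePoint_lt_dom _ _) (S.norm_tubePoint_lt_dom _ _)
      (Sum.inl_injective h)

/-- Every point of `Mᵗ` comes from the regular part of `Y` or lies on an exceptional divisor. -/
theorem mem_range_or (S : DesingData A σ p ζ c t) (m : Resolution σ ζ c n t) :
    m ∈ range (S.outerMap n) ∨ ∃ j q, q.1.1 = 0 ∧ m = S.tubeMap n j q := by
  rcases S.tubeMap_surj n m with ⟨⟨z, hz⟩, rfl⟩ | ⟨j, q, rfl⟩
  · left
    obtain ⟨y, rfl⟩ := Quot.exists_rep z
    have hy : y ∈ (range p)ᶜ := by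
      rintro ⟨j, rfl⟩
      refine S.mem_outerPiece_iff.1 hz j 0 ?_ ?_
      · rw [norm_zero]
        exact (mul_pos S.rpow_pos S.pos).le
      · rw [S.chart_zero]
        rfl
    refine ⟨⟨y, hy⟩, S.normalForm_injective n ?_⟩
    rw [normalForm_outerMap]
    rfl
  · by_cases hq : q.1.1 = 0
    · exact .inr ⟨j, q, hq, rfl⟩
    · exact .inl ⟨_, (S.tubeMap_eq_outerMap n j ⟨q, hq⟩).symm⟩

end DesingData

/-! ### The topology of the desingularization -/

namespace DesingData

variable {Y : Type*} [TopologicalSpace Y] {A : ComplexOrbifold Y} {σ : Y → Y} {k : ℕ}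
  {p : Fin k → Y} {ζ : ℝ} {c : Fin k → OrbifoldChart Y} {t : ℝ} (n : Fin k → Kind)

theorem continuous_innerMk (S : DesingData A σ p ζ c t) (j : Fin k) :
    Continuous (S.innerMk n j) :=
  ((continuous_aleMk (n j)).comp (Tube.isOpenEmbedding_toHom _).continuous).subtype_mk _

theorem continuous_tubeMap (S : DesingData A σ p ζ c t) (j : Fin k) :
    Continuous (S.tubeMap n j) :=
  continuous_quot_mk.comp (continuous_inr.comp (continuous_sigmaMk.comp (S.continuous_innerMk n j)))

theorem continuous_tubeChart (S : DesingData A σ p ζ c t) (j : Fin k) :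
    Continuous (S.tubeChart n j) := by
  refine Continuous.subtype_mk ?_ _
  exact (c j).continuousOn.comp_continuous
    ((continuous_tubePoint (n j) t _).comp continuous_subtype_val)
    fun q => S.mem_dom j (S.norm_tubePoint_lt_dom _ _)

theorem isOpen_tubeNonzero (R : ℝ) : IsOpen {q : Tube R | q.1.1 ≠ 0} :=
  isOpen_compl_singleton.preimage (by fun_prop : Continuous fun q : Tube R => q.1.1)

theorem isOpen_image_chart (S : DesingData A σ p ζ c t) (j : Fin k)
    {V : Set (Tube (tubeRadius ζ t))} (hV : IsOpen V) :
    IsOpen ((c j).toFun '' (tubePoint (n j) t '' {q ∈ V | q.1.1 ≠ 0})) := by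
  refine (c j).isOpen_image _ ?_ (isOpen_image_tubePoint _ S.mem.1.ne' hV)
  rintro _ ⟨q, -, rfl⟩
  exact S.mem_dom j (S.norm_tubePoint_lt_dom _ _)

theorem isOpenMap_tubeChart (S : DesingData A σ p ζ c t) (j : Fin k) :
    IsOpenMap (S.tubeChart n j) := by
  intro V hV
  have h := S.isOpen_image_chart n j ((isOpen_tubeNonzero _).isOpenMap_subtype_val _ hV)
  convert h.preimage (continuous_subtype_val (p := fun y => y ∈ (range p)ᶜ)) using 1
  ext y
  constructor
  · rintro ⟨q, hq, rfl⟩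
    exact ⟨_, ⟨q.1, ⟨⟨q, hq, rfl⟩, q.2⟩, rfl⟩, rfl⟩
  · rintro ⟨_, ⟨_, ⟨⟨q, hq, rfl⟩, _⟩, rfl⟩, hy⟩
    exact ⟨q, hq, Subtype.ext hy⟩

/-- Over `M₀ᵗ` the map is the projection to `Z`, and near the singular points it is given by
`tubeMap` in the charts, so the preimage of an open set is a union of two kinds of open sets. -/
theorem continuous_outerMap [T2Space Y] (S : DesingData A σ p ζ c t) :
    Continuous (S.outerMap n) := by
  rw [continuous_def]
  intro O hO
  have h1 : IsOpen (Subtype.val '' {z : outerPiece σ ζ c t |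
      (Quot.mk _ (Sum.inl z) : Resolution σ ζ c n t) ∈ O}) :=
    S.isOpen_outerPiece.isOpenMap_subtype_val _
      (hO.preimage (continuous_quot_mk.comp continuous_inl))
  have h2 : ∀ j, IsOpen (OrbitSpace.mk σ ''
      ((c j).toFun '' (tubePoint (n j) t '' {q ∈ S.tubeMap n j ⁻¹' O | q.1.1 ≠ 0}))) := fun j =>
    S.isOpenMap_mk _ (S.isOpen_image_chart n j (hO.preimage (S.continuous_tubeMap n j)))
  have h3 := (h1.union (isOpen_iUnion h2)).preimage
    ((continuous_mk σ).comp (continuous_subtype_val (p := fun y => y ∈ (range p)ᶜ)))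
  convert h3 using 1
  ext y
  simp only [mem_preimage, mem_union, mem_iUnion, Function.comp_apply]
  constructor
  · intro hy
    rcases S.tubeMap_surj n (S.outerMap n y) with ⟨z, hz⟩ | ⟨j, q, hq⟩
    · left
      refine ⟨z, by rw [mem_ofPred_eq, ← hz]; exact hy, ?_⟩
      have := congrArg (S.normalForm n) hz
      rw [normalForm_outerMap] at this
      exact (Sum.inl_injective this).symm
    · right
      have h0 : q.1.1 ≠ 0 := fun h0 => S.tubeMap_notMem_range n j q h0 ⟨y, hq⟩
      refine ⟨j, _, ⟨_, ⟨q, ⟨(hq ▸ hy : S.tubeMap n j q ∈ O), h0⟩, rfl⟩, rfl⟩, ?_⟩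
      have := congrArg (S.normalForm n) hq
      rw [normalForm_outerMap, S.normalForm_tubeMap n j q h0] at this
      exact (Sum.inl_injective this).symm
  · rintro (⟨z, hz, hy⟩ | ⟨j, _, ⟨_, ⟨q, ⟨hq, h0⟩, rfl⟩, rfl⟩, hy⟩)
    · have : S.outerMap n y = Quot.mk _ (Sum.inl z) := by
        apply S.normalForm_injective n
        rw [normalForm_outerMap, normalForm_inl, hy]
      rw [this]
      exact hz
    · have : S.outerMap n y = S.tubeMap n j q := by
        apply S.normalForm_injective n
        rw [normalForm_outerMap, S.normalForm_tubeMap n j q h0, hy]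
      rw [this]
      exact hq

/-- The topology of `Mᵗ` is coinduced by the regular part of `Y` and the tubes. -/
theorem isOpen_resolution_iff [T2Space Y] (S : DesingData A σ p ζ c t)
    (O : Set (Resolution σ ζ c n t)) :
    IsOpen O ↔ IsOpen (S.outerMap n ⁻¹' O) ∧ ∀ j, IsOpen (S.tubeMap n j ⁻¹' O) := by
  refine ⟨fun h => ⟨h.preimage (S.continuous_outerMap n), fun j =>
    h.preimage (S.continuous_tubeMap n j)⟩, fun ⟨h1, h2⟩ => ?_⟩
  refine isQuotientMap_quot_mk.isOpen_preimage.1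
    (isOpen_sum_iff.2 ⟨?_, isOpen_sigma_iff.2 fun j => ?_⟩)
  · have h := S.isOpenMap_mk _ (S.isOpen_compl.isOpenMap_subtype_val _ h1)
    convert! h.preimage (continuous_subtype_val (p := fun z => z ∈ outerPiece σ ζ c t)) using 1
    ext z
    constructor
    · intro hz
      rcases S.mem_range_or n (Quot.mk _ (Sum.inl z)) with ⟨y, hy⟩ | ⟨j, q, hq, h⟩
      · refine ⟨y, ⟨y, by rw [mem_preimage, hy]; exact hz, rfl⟩, ?_⟩
        have := congrArg (S.normalForm n) hy
        rw [normalForm_outerMap] at this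
        exact Sum.inl_injective this
      · have := congrArg (S.normalForm n) h
        rw [S.normalForm_tubeMap_zero n j q hq] at this
        cases this
    · rintro ⟨_, ⟨y, hy, rfl⟩, hyz⟩
      rw [mem_preimage] at hy
      have : S.outerMap n y = Quot.mk _ (Sum.inl z) := by
        apply S.normalForm_injective n
        rw [normalForm_outerMap, normalForm_inl, hyz]
      rw [this] at hy
      exact hy
  · have h := isOpenMap_aleMk (n j) _ ((Tube.isOpenEmbedding_toHom _).isOpenMap _ (h2 j))
    convert! h.preimage (continuous_subtype_val (p := fun x => x ∈ innerPiece ζ t (n j))) using 1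
    ext x
    constructor
    · intro hx
      obtain ⟨q, rfl⟩ := S.innerMk_surjective n j x
      exact ⟨_, ⟨q, hx, rfl⟩, rfl⟩
    · rintro ⟨_, ⟨q, hq, rfl⟩, hx⟩
      obtain rfl : S.innerMk n j q = x := Subtype.ext hx
      exact hq

theorem isOpenMap_maps [T2Space Y] (S : DesingData A σ p ζ c t) :
    IsOpenMap (S.outerMap n) ∧ ∀ j, IsOpenMap (S.tubeMap n j) := by
  refine isOpenMap_of_glued (N := {q : Tube (tubeRadius ζ t) | q.1.1 ≠ 0}) (h := S.tubeChart n)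
    (S.isOpen_resolution_iff n) (isOpen_tubeNonzero _) (S.continuous_tubeChart n)
    (S.isOpenMap_tubeChart n) ?_ (fun j q => S.tubeMap_eq_outerMap n j q)
    (fun j q hq => S.tubeMap_notMem_range n j q (not_not.1 hq)) ?_
    (fun i j q q' h => S.tubeMap_index n h)
  · intro V hV
    have h := S.isOpen_compl.isOpenMap_subtype_val _ hV
    have h' := (h.union (h.preimage S.adm.continuous)).preimage
      (continuous_subtype_val (p := fun y => y ∈ (range p)ᶜ))
    convert h' using 1
    ext y
    constructor
    · rintro ⟨z, hz, hzy⟩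
      rcases (S.outerMap_eq_iff n).1 hzy with h | h
      · exact .inl ⟨z, hz, h.symm⟩
      · exact .inr ⟨z, hz, by rw [h, S.adm.involutive]⟩
    · rintro (⟨z, hz, h⟩ | ⟨z, hz, h⟩)
      · exact ⟨z, hz, (S.outerMap_eq_iff n).2 (.inl h.symm)⟩
      · exact ⟨z, hz, (S.outerMap_eq_iff n).2 (.inr (by rw [h, S.adm.involutive]))⟩
  · rintro j _ ⟨V, hV, rfl⟩
    have hT : IsOpen {q : ℂ × C4 | q.2 ≠ 0 ∧ ‖q.1 • q.2‖ < tubeRadius ζ t} :=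
      (isOpen_compl_singleton.preimage continuous_snd).inter
        (isOpen_lt (f := fun q : ℂ × C4 => ‖q.1 • q.2‖) (by fun_prop) continuous_const)
    have h := (OrbitRel.isOpen_saturation (hV.inter hT)).preimage
        (continuous_subtype_val (p := fun q : ℂ × C4 => q.2 ≠ 0 ∧ ‖q.1 • q.2‖ < tubeRadius ζ t))
    convert h using 1
    ext q
    constructor
    · rintro ⟨q', hq', h⟩
      exact ⟨q'.1, ⟨hq', q'.2⟩, (S.tubeMap_eq_iff n).1 h.symm⟩
    · rintro ⟨q', ⟨hq', h0⟩, h⟩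
      exact ⟨⟨q', h0⟩, hq', ((S.tubeMap_eq_iff n).2 h).symm⟩

end DesingData

/-! ### Contractible neighbourhoods of points of the exceptional divisors -/

section LineBox

/-- Bessel's inequality for the orthogonal vectors `w` and `β w` of equal length. It shows that a
line which makes an angle of less than `π / 4` with `e` is not moved by `β` to another such line.
-/
theorem norm_inner_sq_add_norm_inner_beta_sq_le {e : C4} (he : ‖e‖ = 1) (w : C4) :
    ‖inner ℂ e w‖ ^ 2 + ‖inner ℂ e (beta w)‖ ^ 2 ≤ ‖w‖ ^ 2 := by
  set a := inner ℂ e w with ha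
  set b := inner ℂ e (beta w) with hb
  have hbn : ‖beta w‖ = ‖w‖ := beta.norm_map w
  -- apply the Cauchy-Schwarz inequality to `e` and the combination below
  have h1 : inner ℂ e (starRingEnd ℂ a • w + starRingEnd ℂ b • beta w) =
      ((‖a‖ ^ 2 + ‖b‖ ^ 2 : ℝ) : ℂ) := by
    rw [inner_add_right, inner_smul_right, inner_smul_right, ← ha, ← hb, Complex.conj_mul',
      Complex.conj_mul']
    push_cast
    rfl
  have h2 : ‖starRingEnd ℂ a • w + starRingEnd ℂ b • beta w‖ ^ 2 =
      (‖a‖ ^ 2 + ‖b‖ ^ 2) * ‖w‖ ^ 2 := by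
    have : inner ℂ (starRingEnd ℂ a • w) (starRingEnd ℂ b • beta w) = 0 := by
      rw [inner_smul_left, inner_smul_right, inner_beta_self, mul_zero, mul_zero]
    rw [sq, norm_add_sq_eq_norm_sq_add_norm_sq_of_inner_eq_zero _ _ this, norm_smul, norm_smul,
      hbn, RCLike.norm_conj, RCLike.norm_conj]
    ring
  have h3 := norm_inner_le_norm (𝕜 := ℂ) e (starRingEnd ℂ a • w + starRingEnd ℂ b • beta w)
  rw [h1, he, one_mul, Complex.norm_real, Real.norm_of_nonneg (by positivity)] at h3
  by_contra hlt
  push Not at hlt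
  have h4 : (‖a‖ ^ 2 + ‖b‖ ^ 2) ^ 2 ≤ (‖a‖ ^ 2 + ‖b‖ ^ 2) * ‖w‖ ^ 2 := by
    rw [← h2]
    gcongr
  nlinarith [sq_nonneg ‖w‖, mul_lt_mul_of_pos_left hlt (lt_of_le_of_lt (sq_nonneg ‖w‖) hlt)]

/-- The points of the tube lying on lines that make an angle of less than `π / 4` with `e`. -/
def lineBox (e : C4) (R : ℝ) : Set (Tube R) := {q | ‖q.1.2‖ ^ 2 < 2 * ‖inner ℂ e q.1.2‖ ^ 2}

theorem isOpen_lineBox (e : C4) (R : ℝ) : IsOpen (lineBox e R) :=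
  isOpen_lt (by fun_prop) (by fun_prop)

/-- In a `lineBox` the antilinear elements of `G` cause no identifications. -/
theorem OrbitRel.of_mem_lineBox {e : C4} (he : ‖e‖ = 1) {R : ℝ} {q q' : Tube R}
    (hq : q ∈ lineBox e R) (hq' : q' ∈ lineBox e R) (h : OrbitRel q.1 q'.1) :
    ∃ ε μ : ℂ, ε ^ 4 = 1 ∧ μ ≠ 0 ∧ q'.1 = (ε * μ⁻¹ * q.1.1, μ • q.1.2) := by
  obtain ⟨ε, μ, hε, hμ, h | h⟩ := h
  · exact ⟨ε, μ, hε, hμ, h⟩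
  · exfalso
    have h1 : ‖q.1.2‖ ^ 2 < 2 * ‖inner ℂ e q.1.2‖ ^ 2 := hq
    have h2 : ‖q'.1.2‖ ^ 2 < 2 * ‖inner ℂ e q'.1.2‖ ^ 2 := hq'
    rw [h, inner_smul_right, norm_smul, norm_mul, LinearIsometryEquiv.norm_map] at h2
    have hμ' : 0 < ‖μ‖ ^ 2 := by positivity
    have h3 : ‖q.1.2‖ ^ 2 < 2 * ‖inner ℂ e (beta q.1.2)‖ ^ 2 := by
      rw [mul_pow, mul_pow] at h2
      nlinarith
    have := norm_inner_sq_add_norm_inner_beta_sq_le he q.1.2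
    linarith

theorem norm_contract_le {e : C4} (he : ‖e‖ = 1) (w : C4) {s : ℝ} (hs : s ∈ unitInterval) :
    ‖(s : ℂ) • w + ((1 - s : ℝ) : ℂ) • inner ℂ e w • e‖ ≤ ‖w‖ := by
  have h1 : ‖inner ℂ e w • e‖ ≤ ‖w‖ := by
    rw [norm_smul, he, mul_one]
    simpa [he] using norm_inner_le_norm (𝕜 := ℂ) e w
  calc _ ≤ ‖(s : ℂ) • w‖ + ‖((1 - s : ℝ) : ℂ) • inner ℂ e w • e‖ := norm_add_le _ _
    _ = s * ‖w‖ + (1 - s) * ‖inner ℂ e w • e‖ := by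
      rw [norm_smul _ w, norm_smul _ (inner ℂ e w • e), Complex.norm_real, Complex.norm_real,
        Real.norm_of_nonneg hs.1, Real.norm_of_nonneg (by linarith [hs.2])]
    _ ≤ s * ‖w‖ + (1 - s) * ‖w‖ := by
      have : 0 ≤ 1 - s := by linarith [hs.2]
      gcongr
    _ = ‖w‖ := by ring

theorem inner_contract {e : C4} (he : ‖e‖ = 1) (w : C4) (s : ℝ) :
    inner ℂ e ((s : ℂ) • w + ((1 - s : ℝ) : ℂ) • inner ℂ e w • e) = inner ℂ e w := by
  rw [inner_add_right, inner_smul_right, inner_smul_right, inner_smul_right,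
    inner_self_eq_norm_sq_to_K, he]
  push_cast
  ring

theorem contract_mem_box {e : C4} (he : ‖e‖ = 1) {w : C4}
    (hw : ‖w‖ ^ 2 < 2 * ‖inner ℂ e w‖ ^ 2) {s : ℝ} (hs : s ∈ unitInterval) :
    ‖(s : ℂ) • w + ((1 - s : ℝ) : ℂ) • inner ℂ e w • e‖ ^ 2 <
      2 * ‖inner ℂ e ((s : ℂ) • w + ((1 - s : ℝ) : ℂ) • inner ℂ e w • e)‖ ^ 2 := by
  rw [inner_contract he]
  refine lt_of_le_of_lt ?_ hw
  gcongr
  exact norm_contract_le he w hs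

theorem ne_zero_of_box {e w : C4} (hw : ‖w‖ ^ 2 < 2 * ‖inner ℂ e w‖ ^ 2) : w ≠ 0 := by
  rintro rfl
  simp at hw

/-- The contraction of `lineBox e R` towards the point `(0, e)`: the fibre coordinate `a` is scaled
to `0`, and `w` moves on a segment to its orthogonal projection to the line of `e`. Each stage is
homogeneous in `(a, w)`, so the contraction respects the orbit relation. -/
noncomputable def boxContract {e : C4} (he : ‖e‖ = 1) {R : ℝ}
    (x : unitInterval × lineBox e R) : lineBox e R :=
  ⟨⟨((x.1 : ℝ) * x.2.1.1.1,
      ((x.1 : ℝ) : ℂ) • x.2.1.1.2 + ((1 - x.1 : ℝ) : ℂ) • inner ℂ e x.2.1.1.2 • e),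
    ne_zero_of_box (contract_mem_box he x.2.2 x.1.2), by
      refine lt_of_le_of_lt ?_ x.2.1.2.2
      rw [norm_smul, norm_smul, norm_mul, Complex.norm_real, Real.norm_of_nonneg x.1.2.1]
      have h1 := norm_contract_le he x.2.1.1.2 x.1.2
      have h2 := x.1.2.2
      have h3 := x.1.2.1
      calc _ ≤ 1 * ‖x.2.1.1.1‖ * ‖x.2.1.1.2‖ := by gcongr
        _ = _ := by rw [one_mul]⟩, contract_mem_box he x.2.2 x.1.2⟩

theorem continuous_boxContract {e : C4} (he : ‖e‖ = 1) (R : ℝ) :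
    Continuous (boxContract he (R := R)) := by
  refine Continuous.subtype_mk (Continuous.subtype_mk ?_ _) _
  have h1 : Continuous fun x : unitInterval × lineBox e R => ((x.1 : ℝ) : ℂ) := by fun_prop
  have h2 : Continuous fun x : unitInterval × lineBox e R => x.2.1.1 := by fun_prop
  fun_prop

theorem boxContract_orbitRel {e : C4} (he : ‖e‖ = 1) {R : ℝ} {b b' : lineBox e R}
    (s : unitInterval) (h : OrbitRel b.1.1 b'.1.1) :
    OrbitRel (boxContract he (s, b)).1.1 (boxContract he (s, b')).1.1 := by
  obtain ⟨ε, μ, hε, hμ, h⟩ := OrbitRel.of_mem_lineBox he b.2 b'.2 h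
  refine ⟨ε, μ, hε, hμ, .inl (Prod.ext ?_ ?_)⟩
  · change ((s : ℝ) : ℂ) * b'.1.1.1 = ε * μ⁻¹ * (((s : ℝ) : ℂ) * b.1.1.1)
    rw [h]
    ring
  · change ((s : ℝ) : ℂ) • b'.1.1.2 + ((1 - s : ℝ) : ℂ) • inner ℂ e b'.1.1.2 • e =
      μ • (((s : ℝ) : ℂ) • b.1.1.2 + ((1 - s : ℝ) : ℂ) • inner ℂ e b.1.1.2 • e)
    rw [h]
    dsimp only
    rw [inner_smul_right, smul_add, smul_smul, smul_smul, smul_smul, smul_smul, smul_smul]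
    congr 2 <;> ring

theorem joinedIn_punctured_ball {a a' : ℂ} {r : ℝ} (ha : a ≠ 0) (ha' : a' ≠ 0) (hr : ‖a‖ < r)
    (hr' : ‖a'‖ < r) : JoinedIn {z : ℂ | z ≠ 0 ∧ ‖z‖ < r} a a' := by
  -- the exponential of the segment between the logarithms avoids `0`
  refine ⟨⟨⟨fun s => Complex.exp ((1 - (s : ℝ)) * Complex.log a + (s : ℝ) * Complex.log a'),
    by fun_prop⟩, by simp [Complex.exp_log ha], by simp [Complex.exp_log ha']⟩,
    fun s => ⟨Complex.exp_ne_zero _, ?_⟩⟩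
  change ‖Complex.exp _‖ < r
  rw [Complex.norm_exp]
  have h1 : ((1 - ((s : ℝ) : ℂ)) * Complex.log a + (s : ℝ) * Complex.log a').re =
      (1 - s) * Real.log ‖a‖ + s * Real.log ‖a'‖ := by
    simp [Complex.log_re]
  have h2 : (1 - s : ℝ) * Real.log ‖a‖ + s * Real.log ‖a'‖ ≤
      max (Real.log ‖a‖) (Real.log ‖a'‖) := by
    have h3 : 0 ≤ (1 - s : ℝ) := by linarith [s.2.2]
    have h4 := s.2.1
    calc _ ≤ (1 - s : ℝ) * max (Real.log ‖a‖) (Real.log ‖a'‖) +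
        s * max (Real.log ‖a‖) (Real.log ‖a'‖) := by
          gcongr
          exacts [le_max_left _ _, le_max_right _ _]
      _ = _ := by ring
  rw [h1]
  refine lt_of_le_of_lt (Real.exp_le_exp.2 h2) ?_
  rcases max_choice (Real.log ‖a‖) (Real.log ‖a'‖) with h | h <;> rw [h, Real.exp_log]
  exacts [hr, norm_pos_iff.2 ha, hr', norm_pos_iff.2 ha']

/-- Two points of the box off the zero section whose `w`-coordinates have the same component `d`
along `e` are joined off the zero section: both are moved to have `w = d e`, and then `a` moves in a
punctured disc. -/
theorem joinedIn_lineBox {e : C4} (he : ‖e‖ = 1) {R : ℝ} {a a' : ℂ} {w w' : C4}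
    (ha : a ≠ 0) (ha' : a' ≠ 0) (hw : ‖w‖ ^ 2 < 2 * ‖inner ℂ e w‖ ^ 2)
    (hw' : ‖w'‖ ^ 2 < 2 * ‖inner ℂ e w'‖ ^ 2) (hR : ‖a • w‖ < R) (hR' : ‖a' • w'‖ < R)
    (h : inner ℂ e w = inner ℂ e w') :
    JoinedIn {q : ℂ × C4 | q.1 ≠ 0 ∧ ‖q.2‖ ^ 2 < 2 * ‖inner ℂ e q.2‖ ^ 2 ∧ ‖q.1 • q.2‖ < R}
      (a, w) (a', w') := by
  have key : ∀ (a : ℂ) (w : C4), a ≠ 0 → ‖w‖ ^ 2 < 2 * ‖inner ℂ e w‖ ^ 2 → ‖a • w‖ < R →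
      JoinedIn {q : ℂ × C4 | q.1 ≠ 0 ∧ ‖q.2‖ ^ 2 < 2 * ‖inner ℂ e q.2‖ ^ 2 ∧ ‖q.1 • q.2‖ < R}
        (a, inner ℂ e w • e) (a, w) := by
    intro a w ha hw hR
    apply JoinedIn.of_segment_subset
    rw [segment_eq_image]
    rintro _ ⟨s, hs, rfl⟩
    have e1 : (1 - s) • (a, inner ℂ e w • e) + s • (a, w) =
        (a, (s : ℂ) • w + ((1 - s : ℝ) : ℂ) • inner ℂ e w • e) := by
      refine Prod.ext ?_ ?_
      · simp only [Prod.smul_mk, Prod.mk_add_mk, Complex.real_smul]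
        push_cast
        ring
      · simp only [Prod.smul_mk, Prod.mk_add_mk, Complex.coe_smul]
        rw [add_comm]
    dsimp only
    rw [e1]
    refine ⟨ha, contract_mem_box he hw hs, lt_of_le_of_lt ?_ hR⟩
    rw [norm_smul, norm_smul]
    gcongr
    exact norm_contract_le he w hs
  refine (key a w ha hw hR).symm.trans (JoinedIn.trans ?_ (key a' w' ha' hw' hR'))
  rw [← h]
  set d := inner ℂ e w with hd
  have hd0 : 0 < ‖d‖ := by
    rw [norm_pos_iff]
    intro h0
    rw [h0] at hw
    norm_num at hw
    nlinarith [norm_nonneg w]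
  have hdw : ‖d‖ ≤ ‖w‖ := by simpa [he] using norm_inner_le_norm (𝕜 := ℂ) e w
  have hdw' : ‖d‖ ≤ ‖w'‖ := by
    rw [h]
    simpa [he] using norm_inner_le_norm (𝕜 := ℂ) e w'
  obtain ⟨γ, hγ⟩ := joinedIn_punctured_ball (r := R / ‖d‖) ha ha'
    ((lt_div_iff₀ hd0).2 (lt_of_le_of_lt (by rw [norm_smul]; gcongr) hR))
    ((lt_div_iff₀ hd0).2 (lt_of_le_of_lt (by rw [norm_smul]; gcongr) hR'))
  refine ⟨γ.map (f := fun z : ℂ => (z, d • e)) (by fun_prop), fun s => ?_⟩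
  obtain ⟨h1, h2⟩ := hγ s
  refine ⟨h1, ?_, ?_⟩
  · simp only [Path.map_coe, Function.comp_apply, norm_smul, he, inner_smul_right,
      inner_self_eq_norm_sq_to_K]
    simp
    nlinarith
  · simp only [Path.map_coe, Function.comp_apply, norm_smul, he, mul_one]
    rwa [lt_div_iff₀ hd0] at h2

end LineBox

namespace DesingData

variable {Y : Type*} [TopologicalSpace Y] {A : ComplexOrbifold Y} {σ : Y → Y} {k : ℕ}
  {p : Fin k → Y} {ζ : ℝ} {c : Fin k → OrbifoldChart Y} {t : ℝ} (n : Fin k → Kind)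

/-- Paths with the same ends in the image of a box are homotopic, because `boxContract` descends to
this image. -/
theorem homotopic_of_range_subset_box [T2Space Y] (S : DesingData A σ p ζ c t) (j : Fin k) {e : C4}
    (he : ‖e‖ = 1) {x y : Resolution σ ζ c n t} (γ γ' : Path x y)
    (hγ : range γ ⊆ S.tubeMap n j '' lineBox e (tubeRadius ζ t))
    (hγ' : range γ' ⊆ S.tubeMap n j '' lineBox e (tubeRadius ζ t)) : γ.Homotopic γ' := by
  have hr : range (fun b : lineBox e (tubeRadius ζ t) => S.tubeMap n j b) =
      S.tubeMap n j '' lineBox e (tubeRadius ζ t) := by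
    rw [image_eq_range]
  have hR : 0 < tubeRadius ζ t := by
    have := S.rpow_pos
    have := S.pos
    have := S.mem.1
    unfold tubeRadius
    positivity
  have he0 : e ≠ 0 := by
    rintro rfl
    simp at he
  let b₀ : lineBox e (tubeRadius ζ t) :=
    ⟨⟨(0, e), he0, by simpa using hR⟩, by
      change ‖e‖ ^ 2 < 2 * ‖inner ℂ e e‖ ^ 2
      rw [inner_self_eq_norm_sq_to_K, he]
      norm_num⟩
  refine homotopic_of_equivariant_contraction
    (q := fun b : lineBox e (tubeRadius ζ t) => S.tubeMap n j b)
    ((S.continuous_tubeMap n j).comp continuous_subtype_val)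
    (((S.isOpenMap_maps n).2 j).comp (isOpen_lineBox e _).isOpenMap_subtype_val)
    (boxContract he) (continuous_boxContract he _) b₀ ?_ ?_ ?_ γ γ' (hr ▸ hγ) (hr ▸ hγ')
  · rintro ⟨⟨⟨a, w⟩, hw, hwR⟩, hb⟩
    have h0 : inner ℂ e w ≠ 0 := by
      intro h0
      have hb' : ‖w‖ ^ 2 < 2 * ‖inner ℂ e w‖ ^ 2 := hb
      rw [h0] at hb'
      norm_num at hb'
      nlinarith [norm_nonneg w]
    refine S.tubeMap_eq_of_orbitRel n ⟨1, (inner ℂ e w)⁻¹, by simp, inv_ne_zero h0, .inl ?_⟩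
    simp [boxContract, b₀, smul_smul, inv_mul_cancel₀ h0]
  · rintro ⟨⟨⟨a, w⟩, hw, hwR⟩, hb⟩
    apply Subtype.ext
    apply Subtype.ext
    simp [boxContract]
  · intro b b' s h
    exact S.tubeMap_eq_of_orbitRel n (boxContract_orbitRel he s ((S.tubeMap_eq_iff n).1 h))

/-- Off the exceptional divisor the image of a box is path connected, by paths which come from the
regular part of `Y`. -/
theorem tubeChart_joined (S : DesingData A σ p ζ c t) (j : Fin k) {e : C4} (he : ‖e‖ = 1)
    {q q' : Tube (tubeRadius ζ t)} (hq : q ∈ lineBox e (tubeRadius ζ t))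
    (hq' : q' ∈ lineBox e (tubeRadius ζ t)) (h0 : q.1.1 ≠ 0) (h0' : q'.1.1 ≠ 0) :
    ∃ (y : ((range p)ᶜ : Set Y)) (δ : Path (S.tubeChart n j ⟨q, h0⟩) y),
      S.outerMap n y = S.tubeMap n j q' ∧
      ∀ s, S.outerMap n (δ s) ∈ S.tubeMap n j '' lineBox e (tubeRadius ζ t) := by
  have hd : ∀ q : Tube (tubeRadius ζ t), q ∈ lineBox e (tubeRadius ζ t) →
      inner ℂ e q.1.2 ≠ 0 := by
    intro q hq h0
    have hb' : ‖q.1.2‖ ^ 2 < 2 * ‖inner ℂ e q.1.2‖ ^ 2 := hq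
    rw [h0] at hb'
    norm_num at hb'
    nlinarith [norm_nonneg q.1.2]
  -- rescale the representative of the second point so that both have the same component along `e`
  obtain ⟨μ, hμ⟩ : ∃ μ : ℂ, μ = inner ℂ e q.1.2 / inner ℂ e q'.1.2 := ⟨_, rfl⟩
  have hμ0 : μ ≠ 0 := hμ ▸ div_ne_zero (hd q hq) (hd q' hq')
  have hsm : (μ⁻¹ * q'.1.1) • μ • q'.1.2 = q'.1.1 • q'.1.2 := by
    rw [smul_smul, mul_right_comm, inv_mul_cancel₀ hμ0, one_mul]
  have hbox : ‖μ • q'.1.2‖ ^ 2 < 2 * ‖inner ℂ e (μ • q'.1.2)‖ ^ 2 := by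
    have hb' : ‖q'.1.2‖ ^ 2 < 2 * ‖inner ℂ e q'.1.2‖ ^ 2 := hq'
    have hμ' : 0 < ‖μ‖ ^ 2 := by positivity
    rw [inner_smul_right, norm_smul, norm_mul, mul_pow, mul_pow]
    nlinarith
  obtain ⟨γ, hγ⟩ := joinedIn_lineBox he (R := tubeRadius ζ t) h0
    (mul_ne_zero (inv_ne_zero hμ0) h0') hq hbox q.2.2 (by rw [hsm]; exact q'.2.2)
    (by rw [inner_smul_right, hμ, div_mul_cancel₀ _ (hd q' hq')])
  let Γ : unitInterval → {q : Tube (tubeRadius ζ t) | q.1.1 ≠ 0} := fun s =>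
    ⟨⟨γ s, ne_zero_of_box (hγ s).2.1, (hγ s).2.2⟩, (hγ s).1⟩
  have hΓ : Continuous Γ := (γ.continuous.subtype_mk _).subtype_mk _
  refine ⟨S.tubeChart n j (Γ 1), ⟨⟨fun s => S.tubeChart n j (Γ s),
    (S.continuous_tubeChart n j).comp hΓ⟩, ?_, rfl⟩, ?_, fun s => ?_⟩
  · have : Γ 0 = ⟨q, h0⟩ := Subtype.ext (Subtype.ext γ.source)
    exact congrArg (S.tubeChart n j) this
  · rw [← S.tubeMap_eq_outerMap]
    refine (S.tubeMap_eq_of_orbitRel n ⟨1, μ, by simp, hμ0, .inl ?_⟩).symm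
    refine γ.target.trans ?_
    rw [one_mul]
  · exact ⟨(Γ s).1, (hγ s).2.1, S.tubeMap_eq_outerMap n j (Γ s)⟩

end DesingData

/-! ### Loops in the desingularization -/

theorem coordW_beta (v : C4) : coordW (beta v) = Complex.I • coordW v := by
  ext i; fin_cases i <;> simp [coordW, beta, Complex.ext_iff]

theorem exists_unit_mem_lineBox {R : ℝ} (q : Tube R) : ∃ e : C4, ‖e‖ = 1 ∧ q ∈ lineBox e R := by
  have h0 : 0 < ‖q.1.2‖ := norm_pos_iff.2 q.2.1
  refine ⟨((‖q.1.2‖⁻¹ : ℝ) : ℂ) • q.1.2, ?_, ?_⟩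
  · rw [norm_smul, Complex.norm_real, norm_inv, norm_norm, inv_mul_cancel₀ h0.ne']
  · change ‖q.1.2‖ ^ 2 < 2 * ‖inner ℂ (((‖q.1.2‖⁻¹ : ℝ) : ℂ) • q.1.2) q.1.2‖ ^ 2
    rw [inner_smul_left, inner_self_eq_norm_sq_to_K, norm_mul, RCLike.norm_conj,
      Complex.norm_real, norm_inv, norm_norm, norm_pow]
    simp only [RCLike.norm_ofReal, abs_norm]
    have : ‖q.1.2‖⁻¹ * ‖q.1.2‖ ^ 2 = ‖q.1.2‖ := by field_simp
    rw [this]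
    nlinarith

namespace DesingData

variable {Y : Type*} [TopologicalSpace Y] {A : ComplexOrbifold Y} {σ : Y → Y} {k : ℕ}
  {p : Fin k → Y} {ζ : ℝ} {c : Fin k → OrbifoldChart Y} {t : ℝ} (n : Fin k → Kind)

theorem tubeRadius_pos (S : DesingData A σ p ζ c t) : 0 < tubeRadius ζ t := by
  have := S.rpow_pos
  have := S.pos
  have := S.mem.1
  unfold tubeRadius
  positivity

/-- Any point of an exceptional divisor can be joined to the regular part within a given
neighbourhood, along the fibre of the tube. -/
theorem exists_path_to_range (S : DesingData A σ p ζ c t) (x : Resolution σ ζ c n t)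
    (O : Set (Resolution σ ζ c n t)) (hO : IsOpen O) (hx : x ∈ O) :
    ∃ (y : ((range p)ᶜ : Set Y)) (γ : Path x (S.outerMap n y)), range γ ⊆ O := by
  rcases S.mem_range_or n x with ⟨y, rfl⟩ | ⟨j, q, hq, rfl⟩
  · refine ⟨y, Path.refl _, ?_⟩
    rintro _ ⟨s, rfl⟩
    exact hx
  · obtain ⟨⟨a, w⟩, hw, hR⟩ := q
    dsimp only at hq
    subst hq
    let V : Set ℂ := {z | ‖z • w‖ < tubeRadius ζ t}
    have hV : IsOpen V := isOpen_lt (by fun_prop) continuous_const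
    let φ : V → Tube (tubeRadius ζ t) := fun z => ⟨(z.1, w), hw, z.2⟩
    have hφ : Continuous φ := by
      refine Continuous.subtype_mk ?_ _
      fun_prop
    have hW := hV.isOpenMap_subtype_val _ (hO.preimage ((S.continuous_tubeMap n j).comp hφ))
    obtain ⟨r, hr, hball⟩ := Metric.isOpen_iff.1 hW 0 ⟨⟨0, hR⟩, hx, rfl⟩
    have hmem : ∀ s : unitInterval, ((s : ℝ) : ℂ) * (r / 2 : ℝ) ∈ ball (0 : ℂ) r := by
      intro s
      rw [mem_ball_zero_iff, norm_mul, Complex.norm_real, Complex.norm_real,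
        Real.norm_of_nonneg s.2.1, Real.norm_of_nonneg (by positivity)]
      nlinarith [s.2.1, s.2.2]
    have hV' : ∀ s : unitInterval, ((s : ℝ) : ℂ) * (r / 2 : ℝ) ∈ V := fun s => by
      obtain ⟨z, -, hz⟩ := hball (hmem s)
      exact hz ▸ z.2
    let Γ : unitInterval → Tube (tubeRadius ζ t) := fun s => φ ⟨_, hV' s⟩
    have hΓ : Continuous Γ := hφ.comp (Continuous.subtype_mk (by fun_prop) _)
    have h1 : (Γ 1).1.1 ≠ 0 := by
      simp [Γ, φ, hr.ne']
    refine ⟨S.tubeChart n j ⟨Γ 1, h1⟩, ⟨⟨fun s => S.tubeMap n j (Γ s),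
      (S.continuous_tubeMap n j).comp hΓ⟩, ?_, S.tubeMap_eq_outerMap n j ⟨Γ 1, h1⟩⟩, ?_⟩
    · have : Γ 0 = ⟨(0, w), hw, hR⟩ := Subtype.ext (by simp [Γ, φ])
      exact congrArg (S.tubeMap n j) this
    · rintro _ ⟨s, rfl⟩
      obtain ⟨z, hz, hz'⟩ := hball (hmem s)
      have : z = ⟨_, hV' s⟩ := Subtype.ext hz'
      subst this
      exact hz

/-- The restriction of `σ` to the regular part, a free involution. -/
def invol (S : DesingData A σ p ζ c t) (y : ((range p)ᶜ : Set Y)) : ((range p)ᶜ : Set Y) :=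
  ⟨σ y, S.compl_mem y.2⟩

theorem invol_invol (S : DesingData A σ p ζ c t) (y : ((range p)ᶜ : Set Y)) :
    S.invol (S.invol y) = y := Subtype.ext (S.adm.involutive y)

theorem continuous_invol (S : DesingData A σ p ζ c t) : Continuous S.invol :=
  (S.adm.continuous.comp continuous_subtype_val).subtype_mk _

theorem invol_ne (S : DesingData A σ p ζ c t) (y : ((range p)ᶜ : Set Y)) : S.invol y ≠ y :=
  fun h => y.2 (S.apply_eq_self_iff.1 (congrArg Subtype.val h))

theorem outerMap_eq_iff_invol (S : DesingData A σ p ζ c t) {y y' : ((range p)ᶜ : Set Y)} :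
    S.outerMap n y = S.outerMap n y' ↔ y' = y ∨ y' = S.invol y := by
  rw [outerMap_eq_iff, Subtype.ext_iff, Subtype.ext_iff]
  rfl

theorem outerMap_invol (S : DesingData A σ p ζ c t) (y : ((range p)ᶜ : Set Y)) :
    S.outerMap n (S.invol y) = S.outerMap n y :=
  ((S.outerMap_eq_iff_invol n).2 (.inr rfl)).symm

theorem exists_separated_sheets [T2Space Y] (S : DesingData A σ p ζ c t)
    (y : ((range p)ᶜ : Set Y)) :
    ∃ U U' : Set ((range p)ᶜ : Set Y), IsOpen U ∧ IsOpen U' ∧ y ∈ U ∧ S.invol y ∈ U' ∧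
      Disjoint U U' ∧ InjOn (S.outerMap n) U ∧ InjOn (S.outerMap n) U' := by
  obtain ⟨V, V', hV, hV', hy, hy', hd⟩ := t2_separation (S.invol_ne y).symm
  have hinj : ∀ U U' : Set ((range p)ᶜ : Set Y), Disjoint U U' →
      InjOn (S.outerMap n) (U ∩ S.invol ⁻¹' U') := by
    rintro U U' h a ⟨-, ha⟩ b ⟨hb, -⟩ hab
    rcases (S.outerMap_eq_iff_invol n).1 hab with h1 | rfl
    · exact h1.symm
    · exact (h.le_bot ⟨hb, ha⟩).elim
  refine ⟨V ∩ S.invol ⁻¹' V', V' ∩ S.invol ⁻¹' V, hV.inter (hV'.preimage S.continuous_invol),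
    hV'.inter (hV.preimage S.continuous_invol), ⟨hy, hy'⟩, ⟨hy', ?_⟩,
    hd.mono inter_subset_left inter_subset_left, hinj _ _ hd, hinj _ _ hd.symm⟩
  rw [mem_preimage, invol_invol]
  exact hy

/-- The regular part of `Y` is a double cover of its image in `Mᵗ`, because `σ` acts freely on it.
-/
theorem isCoveringMap_outerMap [T2Space Y] (S : DesingData A σ p ζ c t) :
    IsCoveringMap (rangeFactorization (S.outerMap n)) := by
  have hval : ∀ {a b}, rangeFactorization (S.outerMap n) a = rangeFactorization (S.outerMap n) b ↔
      S.outerMap n a = S.outerMap n b := Subtype.ext_iff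
  refine isCoveringMap_of_two_sheets ((S.continuous_outerMap n).subtype_mk _)
    ((S.isOpenMap_maps n).1.subtype_mk _) rangeFactorization_surjective ?_ fun y => ?_
  · intro a b d hab hda hne
    rw [hval, outerMap_eq_iff_invol] at hab hda
    rcases hab with rfl | rfl
    · exact (hne rfl).elim
    · rcases hda with h | h
      · exact .inl h.symm
      · right
        rw [h, invol_invol]
  · obtain ⟨U, U', h1, h2, h3, h4, h5, h6, h7⟩ := S.exists_separated_sheets n y
    exact ⟨S.invol y, U, U', h1, h2, h3, h4, hval.2 (S.outerMap_invol n y), h5,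
      fun a ha b hb h => h6 ha hb (hval.1 h), fun a ha b hb h => h7 ha hb (hval.1 h)⟩

/-- The map `outerMap` as a bundled continuous map. -/
noncomputable def outerCM [T2Space Y] (S : DesingData A σ p ζ c t) :
    C(((range p)ᶜ : Set Y), Resolution σ ζ c n t) := ⟨S.outerMap n, S.continuous_outerMap n⟩

theorem outerCM_invol [T2Space Y] (S : DesingData A σ p ζ c t) (y : ((range p)ᶜ : Set Y)) :
    S.outerCM n (S.invol y) = S.outerCM n y := S.outerMap_invol n y

theorem exists_joined_in_box (S : DesingData A σ p ζ c t) (j : Fin k) {e : C4}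
    (he : ‖e‖ = 1) (a b : ((range p)ᶜ : Set Y))
    (ha : S.outerMap n a ∈ S.tubeMap n j '' lineBox e (tubeRadius ζ t))
    (hb : S.outerMap n b ∈ S.tubeMap n j '' lineBox e (tubeRadius ζ t)) :
    ∃ (y : ((range p)ᶜ : Set Y)) (δ : Path a y), S.outerMap n y = S.outerMap n b ∧
      ∀ s, S.outerMap n (δ s) ∈ S.tubeMap n j '' lineBox e (tubeRadius ζ t) := by
  obtain ⟨q, hq, hqa⟩ := ha
  obtain ⟨q', hq', hqb⟩ := hb
  have h0 : q.1.1 ≠ 0 := fun h => S.tubeMap_notMem_range n j q h ⟨a, hqa.symm⟩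
  have h0' : q'.1.1 ≠ 0 := fun h => S.tubeMap_notMem_range n j q' h ⟨b, hqb.symm⟩
  obtain ⟨y, δ, hy, hδ⟩ := S.tubeChart_joined n j he hq hq' h0 h0'
  rw [S.tubeMap_eq_outerMap n j ⟨q, h0⟩, outerMap_eq_iff_invol] at hqa
  rcases hqa with rfl | rfl
  · exact ⟨y, δ, hy.trans hqb, hδ⟩
  · refine ⟨S.invol y, δ.map S.continuous_invol, ?_, fun s => ?_⟩
    · rw [outerMap_invol, hy, hqb]
    · rw [Path.map_coe, Function.comp_apply, outerMap_invol]
      exact hδ s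

open Path in
/-- Every path in `Mᵗ` between points of the image of the regular part is homotopic to the image of
a path in the regular part. -/
theorem exists_lift [T2Space Y] (S : DesingData A σ p ζ c t) {a b : ((range p)ᶜ : Set Y)}
    (γ : Path (S.outerCM n a) (S.outerCM n b)) :
    ∃ (y : ((range p)ᶜ : Set Y)) (h : S.outerCM n y = S.outerCM n b)
      (δ : Homotopic.Quotient a y),
      δ.map (S.outerCM n) = (Homotopic.Quotient.mk γ).cast rfl h := by
  refine exists_lift_of_covering_off_contractible (S.outerCM n) (S.isOpenMap_maps n).1
    (S.isCoveringMap_outerMap n) (S.exists_path_to_range n) (fun x hx => ?_) γ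
  rcases S.mem_range_or n x with h | ⟨j, q, hq, rfl⟩
  · exact (hx h).elim
  · obtain ⟨e, he, hqe⟩ := exists_unit_mem_lineBox q
    exact ⟨_, (S.isOpenMap_maps n).2 j _ (isOpen_lineBox e _), ⟨q, hqe, rfl⟩,
      fun y z γ γ' => S.homotopic_of_range_subset_box n j he γ γ',
      fun a b => S.exists_joined_in_box n j he a b⟩

theorem pathConnectedSpace_resolution [T2Space Y] (S : DesingData A σ p ζ c t) :
    PathConnectedSpace (Resolution σ ζ c n t) := by
  have := S.adm.simplyConnected
  exact pathConnectedSpace_of_approach (S.outerCM n) (S.exists_path_to_range n)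

open Path in
/-- There are at most two classes of loops in `Mᵗ`: the trivial one and that of the image of any
path in the regular part of `Y` from `y` to `σ y`. -/
theorem loop_class [T2Space Y] (S : DesingData A σ p ζ c t) (y : ((range p)ᶜ : Set Y))
    (δ : Homotopic.Quotient y (S.invol y))
    (Γ : Homotopic.Quotient (S.outerCM n y) (S.outerCM n y)) :
    Γ = .refl _ ∨ Γ = (δ.map (S.outerCM n)).cast rfl (S.outerCM_invol n y).symm := by
  have := S.adm.simplyConnected
  exact loop_class_of_double_cover (S.outerCM n) S.invol
    (fun e e' h => (S.outerMap_eq_iff_invol n).1 h) (S.exists_lift n) y (S.outerCM_invol n y) δ Γ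

open Path in
/-- If some `n j` is `X2`, then in the coordinates `w` the map `β`, which corresponds to `σ`, is
multiplication by `i`. So a path from `y` to `σ y` can be chosen inside a fibre of the tube around
the exceptional divisor, and its image in `Mᵗ` lies in a contractible box. -/
theorem simplyConnectedSpace_resolution [T2Space Y] (S : DesingData A σ p ζ c t)
    (h : ∃ j, n j ≠ Kind.X1) : SimplyConnectedSpace (Resolution σ ζ c n t) := by
  have := S.pathConnectedSpace_resolution n
  obtain ⟨j, hj⟩ := h
  have hj : n j = Kind.X2 := by
    cases h : n j
    · exact (hj h).elim
    · rfl
  let e : C4 := EuclideanSpace.single 0 1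
  have he : ‖e‖ = 1 := by simp [e]
  have he0 : e ≠ 0 := by
    intro h0
    simp [h0] at he
  have hR := S.tubeRadius_pos
  let r : ℝ := tubeRadius ζ t / 2
  have hr : 0 < r := by positivity
  -- the path `θ ↦ (r exp (i θ), e)`, `0 ≤ θ ≤ π / 2`, stays over one complex line
  let Γ : unitInterval → {q : Tube (tubeRadius ζ t) | q.1.1 ≠ 0} := fun s =>
    ⟨⟨(r * Complex.exp (s * (Real.pi / 2) * Complex.I), e), he0, by
      have : ‖Complex.exp (s * (Real.pi / 2) * Complex.I)‖ = 1 := by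
        exact_mod_cast Complex.norm_exp_ofReal_mul_I (s * (Real.pi / 2))
      rw [norm_smul, norm_mul, this, he, Complex.norm_real, Real.norm_of_nonneg hr.le]
      simp only [r]
      linarith⟩, by
      simp [hr.ne', Complex.exp_ne_zero]⟩
  have hΓ : Continuous Γ := by
    refine Continuous.subtype_mk (Continuous.subtype_mk ?_ _) _
    fun_prop
  have hbox : ∀ s, (Γ s).1 ∈ lineBox e (tubeRadius ζ t) := by
    intro s
    change ‖e‖ ^ 2 < 2 * ‖inner ℂ e e‖ ^ 2
    rw [inner_self_eq_norm_sq_to_K, he]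
    norm_num
  have hend : S.tubeChart n j (Γ 1) = S.invol (S.tubeChart n j (Γ 0)) := by
    apply Subtype.ext
    have h0 := (S.tubeChart n j (Γ 0)).2
    change (c j).toFun (tubePoint (n j) t (Γ 1).1) = σ ((c j).toFun (tubePoint (n j) t (Γ 0).1))
    rw [← S.chart_beta j (S.norm_tubePoint_lt_dom _ _)
      (fun h => (Γ 0).2 ((tubePoint_eq_zero_iff S.mem.1.ne' _).1 h))]
    congr 1
    unfold tubePoint
    rw [beta.map_smul]
    congr 1
    rw [LinearIsometryEquiv.symm_apply_eq, hj]
    change _ = coordW (beta _)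
    rw [coordW_beta]
    change _ = Complex.I • coordW (coordW.symm _)
    rw [LinearIsometryEquiv.apply_symm_apply, smul_smul]
    have hI : Complex.exp (Complex.I * (Real.pi / 2)) = Complex.I := by
      rw [mul_comm, Complex.exp_pi_div_two_mul_I]
    simp [Γ, mul_comm, hI]
  let δ : Path (S.tubeChart n j (Γ 0)) (S.invol (S.tubeChart n j (Γ 0))) :=
    ⟨⟨fun s => S.tubeChart n j (Γ s), (S.continuous_tubeChart n j).comp hΓ⟩, rfl, hend⟩
  have hδ : ∀ s, S.outerMap n (δ s) ∈ S.tubeMap n j '' lineBox e (tubeRadius ζ t) := fun s =>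
    ⟨_, hbox s, S.tubeMap_eq_outerMap n j (Γ s)⟩
  refine simplyConnectedSpace_of_loops_eq_refl (S.outerCM n (S.tubeChart n j (Γ 0))) fun γ => ?_
  rcases S.loop_class n _ (.mk δ) γ with h | h
  · exact h
  · rw [h, ← Homotopic.Quotient.mk_map, ← Homotopic.Quotient.mk_cast, ← Homotopic.Quotient.mk_refl,
      Homotopic.Quotient.eq]
    refine S.homotopic_of_range_subset_box n j he _ _ ?_ ?_
    · rintro _ ⟨s, rfl⟩
      exact hδ s
    · rintro _ ⟨s, rfl⟩
      exact hδ 0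

end DesingData

/-! ### The double cover when all pieces are `X₁` -/

theorem norm_inner_beta_left (e w : C4) : ‖inner ℂ (beta e) w‖ = ‖inner ℂ e (beta w)‖ := by
  have : inner ℂ (beta e) w = -starRingEnd ℂ (inner ℂ e (beta w)) := by
    simp [beta, PiLp.inner_apply, Fin.sum_univ_four]
    ring
  rw [this, norm_neg, RCLike.norm_conj]

/-- The relation under which two pairs `(a, w)` represent the same point `([a w], [w])` of the
blow-up `Y₁` of `ℂ⁴ / ⟨α⟩`; this is `OrbitRel` without its antilinear part. -/
def HolRel (q q' : ℂ × C4) : Prop :=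
  ∃ ε μ : ℂ, ε ^ 4 = 1 ∧ μ ≠ 0 ∧ q' = (ε * μ⁻¹ * q.1, μ • q.2)

theorem HolRel.isOpen_saturation {V : Set (ℂ × C4)} (hV : IsOpen V) :
    IsOpen {q | ∃ q' ∈ V, HolRel q q'} := by
  have : {q | ∃ q' ∈ V, HolRel q q'} = ⋃ (ε : ℂ) (μ : ℂ) (_ : ε ^ 4 = 1 ∧ μ ≠ 0),
      (fun q : ℂ × C4 => (ε * μ⁻¹ * q.1, μ • q.2)) ⁻¹' V := by
    ext q
    simp only [HolRel, mem_ofPred_eq, mem_iUnion, mem_preimage]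
    constructor
    · rintro ⟨q', hq', ε, μ, hε, hμ, rfl⟩
      exact ⟨ε, μ, ⟨hε, hμ⟩, hq'⟩
    · rintro ⟨ε, μ, ⟨hε, hμ⟩, h⟩
      exact ⟨_, h, ε, μ, hε, hμ, rfl⟩
  rw [this]
  exact isOpen_iUnion fun ε => isOpen_iUnion fun μ => isOpen_iUnion fun _ =>
    hV.preimage (by fun_prop)

/-- The boxes around `[e]` and `[β e]` in `Y₁` are disjoint, since the lines `e` and `β e` are
orthogonal. -/
theorem not_holRel_of_mem_lineBox {e : C4} (he : ‖e‖ = 1) {R : ℝ} {q q' : Tube R}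
    (hq : q ∈ lineBox e R) (hq' : q' ∈ lineBox (beta e) R) : ¬ HolRel q.1 q'.1 := by
  rintro ⟨ε, μ, -, hμ, h⟩
  have h1 : ‖q.1.2‖ ^ 2 < 2 * ‖inner ℂ e q.1.2‖ ^ 2 := hq
  have h2 : ‖q'.1.2‖ ^ 2 < 2 * ‖inner ℂ (beta e) q'.1.2‖ ^ 2 := hq'
  have hμ' : 0 < ‖μ‖ ^ 2 := by positivity
  rw [h, inner_smul_right, norm_smul, norm_mul, norm_inner_beta_left, mul_pow, mul_pow] at h2
  have := norm_inner_sq_add_norm_inner_beta_sq_le he q.1.2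
  nlinarith

namespace DesingData

variable {Y : Type*} [TopologicalSpace Y] {A : ComplexOrbifold Y} {σ : Y → Y} {k : ℕ}
  {p : Fin k → Y} {ζ : ℝ} {c : Fin k → OrbifoldChart Y} {t : ℝ}

/-- The double cover of `Mᵗ` when all pieces are `X₁`: the resolution of `Y` in which each singular
point `p j` is replaced by the exceptional divisor `ℂℙ³` of `Y₁`, as a set. -/
def DoubleCover (_ : DesingData A σ p ζ c t) : Type _ :=
  ((range p)ᶜ : Set Y) ⊕ Fin k × ℙ ℂ C4

/-- The inclusion of the regular part of `Y` in the double cover. -/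
def coverOuter (S : DesingData A σ p ζ c t) (y : ((range p)ᶜ : Set Y)) : S.DoubleCover := Sum.inl y

open Classical in
/-- The map from homogeneous coordinates on the tube to the double cover. -/
noncomputable def coverTube (S : DesingData A σ p ζ c t) (j : Fin k) (q : Tube (tubeRadius ζ t)) :
    S.DoubleCover :=
  if h : q.1.1 = 0 then Sum.inr (j, Projectivization.mk ℂ q.1.2 q.2.1)
  else Sum.inl (S.tubeChart (fun _ => Kind.X1) j ⟨q, h⟩)

/-- The topology of the double cover is coinduced by the regular part of `Y` and the tubes. -/
noncomputable instance (S : DesingData A σ p ζ c t) : TopologicalSpace S.DoubleCover :=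
  TopologicalSpace.coinduced S.coverOuter inferInstance ⊔
    ⨆ j, TopologicalSpace.coinduced (S.coverTube j) inferInstance

theorem isOpen_doubleCover_iff (S : DesingData A σ p ζ c t) (O : Set S.DoubleCover) :
    IsOpen O ↔ IsOpen (S.coverOuter ⁻¹' O) ∧ ∀ j, IsOpen (S.coverTube j ⁻¹' O) := by
  have h : IsOpen O ↔ IsOpen[TopologicalSpace.coinduced S.coverOuter inferInstance] O ∧
    IsOpen[⨆ j, TopologicalSpace.coinduced (S.coverTube j) inferInstance] O := Iff.rfl
  rw [h, isOpen_iSup_iff]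
  rfl

theorem coverTube_of_eq_zero (S : DesingData A σ p ζ c t) (j : Fin k) {q : Tube (tubeRadius ζ t)}
    (h : q.1.1 = 0) : S.coverTube j q = Sum.inr (j, Projectivization.mk ℂ q.1.2 q.2.1) :=
  dif_pos h

theorem coverTube_of_ne_zero (S : DesingData A σ p ζ c t) (j : Fin k)
    (q : {q : Tube (tubeRadius ζ t) | q.1.1 ≠ 0}) :
    S.coverTube j q = S.coverOuter (S.tubeChart (fun _ => Kind.X1) j q) :=
  dif_neg q.2

theorem coverTube_eq_iff (S : DesingData A σ p ζ c t) {j : Fin k} {q q' : Tube (tubeRadius ζ t)} :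
    S.coverTube j q = S.coverTube j q' ↔ HolRel q.1 q'.1 := by
  have ht : t ≠ 0 := S.mem.1.ne'
  have hε0 : ∀ {ε : ℂ}, ε ^ 4 = 1 → ε ≠ 0 := by
    rintro _ hε rfl
    norm_num at hε
  by_cases hq : q.1.1 = 0 <;> by_cases hq' : q'.1.1 = 0
  · rw [S.coverTube_of_eq_zero j hq, S.coverTube_of_eq_zero j hq']
    refine (Sum.inr_injective.eq_iff.trans (Prod.mk_right_injective j).eq_iff).trans ?_
    rw [eq_comm, Projectivization.mk_eq_mk_iff']
    constructor
    · rintro ⟨a, ha⟩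
      refine ⟨1, a, one_pow 4, ?_, Prod.ext ?_ ha.symm⟩
      · rintro rfl
        rw [zero_smul] at ha
        exact q'.2.1 ha.symm
      · rw [hq, hq', mul_zero]
    · rintro ⟨ε, μ, -, -, h⟩
      exact ⟨μ, (congrArg Prod.snd h).symm⟩
  · rw [S.coverTube_of_eq_zero j hq, S.coverTube_of_ne_zero j ⟨q', hq'⟩]
    refine iff_of_false (fun h => by cases h) ?_
    rintro ⟨ε, μ, -, -, h⟩
    exact hq' (by rw [h, hq, mul_zero])
  · rw [S.coverTube_of_ne_zero j ⟨q, hq⟩, S.coverTube_of_eq_zero j hq']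
    refine iff_of_false (fun h => by cases h) ?_
    rintro ⟨ε, μ, hε, hμ, h⟩
    exact mul_ne_zero (mul_ne_zero (hε0 hε) (inv_ne_zero hμ)) hq
      ((congrArg Prod.fst h).symm.trans hq')
  · rw [S.coverTube_of_ne_zero j ⟨q, hq⟩, S.coverTube_of_ne_zero j ⟨q', hq'⟩]
    refine (Sum.inl_injective.eq_iff.trans Subtype.ext_iff).trans ((S.chart_eq_iff j
      (S.norm_tubePoint_lt_dom _ _) (S.norm_tubePoint_lt_dom _ _)).trans ?_)
    have h1 : ∀ q : Tube (tubeRadius ζ t), tubePoint Kind.X1 t q = t • (q.1.1 • q.1.2) :=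
      fun _ => rfl
    simp only [h1]
    constructor
    · rintro ⟨ε, hε, h⟩
      rw [smul_comm ε, (smul_right_injective C4 ht).eq_iff, smul_smul, ← eq_inv_smul_iff₀ hq',
        smul_smul] at h
      have := hε0 hε
      refine ⟨ε, _, hε, ?_, Prod.ext ?_ h⟩
      · positivity
      · simp only
        field_simp
    · rintro ⟨ε, μ, hε, hμ, h⟩
      refine ⟨ε, hε, ?_⟩
      rw [h, smul_comm ε, smul_smul, smul_smul]
      congr 2
      field_simp

theorem coverOuter_injective (S : DesingData A σ p ζ c t) : Function.Injective S.coverOuter :=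
  Sum.inl_injective

theorem isOpenMap_cover [T2Space Y] (S : DesingData A σ p ζ c t) :
    IsOpenMap S.coverOuter ∧ ∀ j, IsOpenMap (S.coverTube j) := by
  refine isOpenMap_of_glued (N := {q : Tube (tubeRadius ζ t) | q.1.1 ≠ 0})
    (h := S.tubeChart fun _ => Kind.X1) S.isOpen_doubleCover_iff (isOpen_tubeNonzero _)
    (S.continuous_tubeChart _) (S.isOpenMap_tubeChart _) ?_ S.coverTube_of_ne_zero ?_ ?_ ?_
  · intro V hV
    rwa [preimage_image_eq _ S.coverOuter_injective]
  · rintro j q hq ⟨y, hy⟩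
    rw [S.coverTube_of_eq_zero j (not_not.1 hq)] at hy
    cases hy
  · rintro j _ ⟨V, hV, rfl⟩
    have hT : IsOpen {q : ℂ × C4 | q.2 ≠ 0 ∧ ‖q.1 • q.2‖ < tubeRadius ζ t} :=
      (isOpen_compl_singleton.preimage continuous_snd).inter
        (isOpen_lt (f := fun q : ℂ × C4 => ‖q.1 • q.2‖) (by fun_prop) continuous_const)
    have h := (HolRel.isOpen_saturation (hV.inter hT)).preimage
        (continuous_subtype_val (p := fun q : ℂ × C4 => q.2 ≠ 0 ∧ ‖q.1 • q.2‖ < tubeRadius ζ t))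
    convert h using 1
    ext q
    constructor
    · rintro ⟨q', hq', h⟩
      exact ⟨q'.1, ⟨hq', q'.2⟩, S.coverTube_eq_iff.1 h.symm⟩
    · rintro ⟨q', ⟨hq', h0⟩, h⟩
      exact ⟨⟨q', h0⟩, hq', (S.coverTube_eq_iff.2 h).symm⟩
  · intro i j q q' h
    by_cases hq : q.1.1 = 0 <;> by_cases hq' : q'.1.1 = 0
    · rw [S.coverTube_of_eq_zero i hq, S.coverTube_of_eq_zero j hq'] at h
      exact congrArg Prod.fst (Sum.inr_injective h)
    · rw [S.coverTube_of_eq_zero i hq, S.coverTube_of_ne_zero j ⟨q', hq'⟩] at h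
      cases h
    · rw [S.coverTube_of_ne_zero i ⟨q, hq⟩, S.coverTube_of_eq_zero j hq'] at h
      cases h
    · rw [S.coverTube_of_ne_zero i ⟨q, hq⟩, S.coverTube_of_ne_zero j ⟨q', hq'⟩] at h
      have h1 := congrArg Subtype.val (S.coverOuter_injective h)
      exact S.index_eq (S.norm_tubePoint_lt_dom _ _) (S.norm_tubePoint_lt_dom _ _)
        (congrArg (OrbitSpace.mk σ) h1)

theorem continuous_coverOuter (S : DesingData A σ p ζ c t) : Continuous S.coverOuter :=
  continuous_def.2 fun O hO => ((S.isOpen_doubleCover_iff O).1 hO).1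

/-- The point of the tube with coordinates `(0, w)`, on the exceptional divisor. -/
def zeroSection (S : DesingData A σ p ζ c t) (w : C4) (hw : w ≠ 0) : Tube (tubeRadius ζ t) :=
  ⟨(0, w), hw, by rw [zero_smul, norm_zero]; exact S.tubeRadius_pos⟩

theorem doubleCover_cases (S : DesingData A σ p ζ c t) (z : S.DoubleCover) :
    (∃ y, z = S.coverOuter y) ∨ ∃ j w hw, z = S.coverTube j (S.zeroSection w hw) := by
  rcases z with y | ⟨j, ℓ⟩
  · exact .inl ⟨y, rfl⟩
  · induction ℓ using Projectivization.ind with | h w hw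
    exact .inr ⟨j, w, hw, (S.coverTube_of_eq_zero j (q := S.zeroSection w hw) rfl).symm⟩

/-- The projection of the double cover to `Mᵗ`. On the exceptional divisors it is the quotient map
of `ℂℙ³` by the free antiholomorphic involution induced by `β`. -/
noncomputable def coverProj (S : DesingData A σ p ζ c t) :
    S.DoubleCover → Resolution σ ζ c (fun _ => Kind.X1) t
  | .inl y => S.outerMap _ y
  | .inr (j, ℓ) => S.tubeMap _ j (S.zeroSection ℓ.rep ℓ.rep_nonzero)

theorem coverProj_coverOuter (S : DesingData A σ p ζ c t) (y : ((range p)ᶜ : Set Y)) :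
    S.coverProj (S.coverOuter y) = S.outerMap _ y := rfl

theorem coverProj_coverTube (S : DesingData A σ p ζ c t) (j : Fin k)
    (q : Tube (tubeRadius ζ t)) : S.coverProj (S.coverTube j q) = S.tubeMap _ j q := by
  by_cases hq : q.1.1 = 0
  · rw [S.coverTube_of_eq_zero j hq]
    obtain ⟨a, ha⟩ := Projectivization.exists_smul_eq_mk_rep ℂ q.1.2 q.2.1
    refine (S.tubeMap_eq_of_orbitRel _ ⟨1, a, one_pow 4, a.ne_zero, .inl (Prod.ext ?_ ?_)⟩).symm
    · change (0 : ℂ) = 1 * (a : ℂ)⁻¹ * q.1.1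
      rw [hq, mul_zero]
    · exact ha.symm
  · rw [S.coverTube_of_ne_zero j ⟨q, hq⟩, coverProj_coverOuter]
    exact (S.tubeMap_eq_outerMap _ j ⟨q, hq⟩).symm

theorem continuous_coverProj [T2Space Y] (S : DesingData A σ p ζ c t) :
    Continuous S.coverProj := by
  refine continuous_def.2 fun O hO => (S.isOpen_doubleCover_iff _).2 ⟨?_, fun j => ?_⟩
  · exact hO.preimage (S.continuous_outerMap _)
  · have := hO.preimage (S.continuous_tubeMap _ j)
    convert this using 1
    ext q
    rw [mem_preimage, mem_preimage, coverProj_coverTube]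
    rfl

theorem isOpenMap_coverProj [T2Space Y] (S : DesingData A σ p ζ c t) :
    IsOpenMap S.coverProj := by
  intro O hO
  rw [isOpen_doubleCover_iff] at hO
  have : S.coverProj '' O = S.outerMap _ '' (S.coverOuter ⁻¹' O) ∪
      ⋃ j, S.tubeMap _ j '' (S.coverTube j ⁻¹' O) := by
    ext m
    simp only [mem_union, mem_iUnion]
    constructor
    · rintro ⟨z, hz, rfl⟩
      rcases S.doubleCover_cases z with ⟨y, rfl⟩ | ⟨j, w, hw, rfl⟩
      · exact .inl ⟨y, hz, rfl⟩
      · exact .inr ⟨j, _, hz, (S.coverProj_coverTube j _).symm⟩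
    · rintro (⟨y, hy, rfl⟩ | ⟨j, q, hq, rfl⟩)
      · exact ⟨_, hy, rfl⟩
      · exact ⟨_, hq, S.coverProj_coverTube j q⟩
  rw [this]
  exact ((S.isOpenMap_maps _).1 _ hO.1).union
    (isOpen_iUnion fun j => (S.isOpenMap_maps _).2 j _ (hO.2 j))

theorem coverProj_surjective (S : DesingData A σ p ζ c t) : Function.Surjective S.coverProj := by
  intro m
  rcases S.mem_range_or _ m with ⟨y, rfl⟩ | ⟨j, q, -, rfl⟩
  · exact ⟨S.coverOuter y, rfl⟩
  · exact ⟨_, S.coverProj_coverTube j q⟩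

theorem coverProj_zeroSection_eq_iff (S : DesingData A σ p ζ c t) (j : Fin k) {w : C4} (hw : w ≠ 0)
    (z : S.DoubleCover) :
    S.coverProj z = S.coverProj (S.coverTube j (S.zeroSection w hw)) ↔
      z = S.coverTube j (S.zeroSection w hw) ∨
        z = S.coverTube j (S.zeroSection (beta w) (beta_ne_zero hw)) := by
  constructor
  · intro h
    rcases S.doubleCover_cases z with ⟨y, rfl⟩ | ⟨i, w', hw', rfl⟩
    · rw [coverProj_coverOuter, coverProj_coverTube] at h
      exact (S.tubeMap_notMem_range _ j _ rfl ⟨y, h⟩).elim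
    · rw [coverProj_coverTube, coverProj_coverTube] at h
      obtain rfl := S.tubeMap_index _ h
      obtain ⟨ε, μ, hε, hμ, h | h⟩ := (S.tubeMap_eq_iff _).1 h.symm
      · exact .inl (S.coverTube_eq_iff.2 ⟨ε, μ, hε, hμ, h⟩).symm
      · have h2 : w' = μ • beta w := congrArg Prod.snd h
        refine .inr (S.coverTube_eq_iff.2 ⟨1, μ, one_pow 4, hμ, Prod.ext ?_ h2⟩).symm
        simp [zeroSection]
  · rintro (rfl | rfl)
    · rfl
    · rw [coverProj_coverTube, coverProj_coverTube]
      refine (S.tubeMap_eq_of_orbitRel _ ⟨1, 1, one_pow 4, one_ne_zero, .inr ?_⟩).symm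
      simp [zeroSection]

/-- Over the regular part the sheets are separated by `σ`, and near the exceptional divisors they
are the boxes around the orthogonal lines `[e]` and `[β e]`. -/
theorem isCoveringMap_coverProj [T2Space Y] (S : DesingData A σ p ζ c t) :
    IsCoveringMap S.coverProj := by
  have hfib : ∀ z : S.DoubleCover, ∃ z', ∀ b, S.coverProj b = S.coverProj z → b = z ∨ b = z' := by
    intro z
    rcases S.doubleCover_cases z with ⟨y, rfl⟩ | ⟨j, w, hw, rfl⟩
    · refine ⟨S.coverOuter (S.invol y), fun b hb => ?_⟩
      rcases S.doubleCover_cases b with ⟨y', rfl⟩ | ⟨j, w, hw, rfl⟩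
      · rcases (S.outerMap_eq_iff_invol _).1 hb.symm with h | h
        · exact .inl (congrArg _ h)
        · exact .inr (congrArg _ h)
      · rw [coverProj_coverTube] at hb
        exact (S.tubeMap_notMem_range _ j _ rfl ⟨y, hb.symm⟩).elim
    · exact ⟨_, fun b => (S.coverProj_zeroSection_eq_iff j hw b).1⟩
  refine isCoveringMap_of_two_sheets S.continuous_coverProj S.isOpenMap_coverProj
    S.coverProj_surjective ?_ fun z => ?_
  · intro a b d hab hda hne
    obtain ⟨z', hz'⟩ := hfib a
    rcases hz' b hab.symm with rfl | rfl
    · exact (hne rfl).elim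
    · exact hz' d hda
  · rcases S.doubleCover_cases z with ⟨y, rfl⟩ | ⟨j, w, hw, rfl⟩
    · obtain ⟨U, U', hU, hU', hy, hy', hd, hi, hi'⟩ :=
        S.exists_separated_sheets (fun _ => Kind.X1) y
      refine ⟨S.coverOuter (S.invol y), S.coverOuter '' U, S.coverOuter '' U',
        S.isOpenMap_cover.1 _ hU, S.isOpenMap_cover.1 _ hU', ⟨y, hy, rfl⟩, ⟨_, hy', rfl⟩,
        S.outerMap_invol _ y, (disjoint_image_iff S.coverOuter_injective).2 hd, ?_, ?_⟩
      · rintro _ ⟨a, ha, rfl⟩ _ ⟨b, hb, rfl⟩ h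
        exact congrArg _ (hi ha hb h)
      · rintro _ ⟨a, ha, rfl⟩ _ ⟨b, hb, rfl⟩ h
        exact congrArg _ (hi' ha hb h)
    · obtain ⟨e, he, hwe⟩ := exists_unit_mem_lineBox (S.zeroSection w hw)
      have he' : ‖beta e‖ = 1 := by rw [LinearIsometryEquiv.norm_map, he]
      have hinj : ∀ e : C4, ‖e‖ = 1 →
          InjOn S.coverProj (S.coverTube j '' lineBox e (tubeRadius ζ t)) := by
        rintro e he _ ⟨a, ha, rfl⟩ _ ⟨b, hb, rfl⟩ h
        rw [coverProj_coverTube, coverProj_coverTube, tubeMap_eq_iff] at h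
        exact S.coverTube_eq_iff.2 (OrbitRel.of_mem_lineBox he ha hb h)
      refine ⟨S.coverTube j (S.zeroSection (beta w) (beta_ne_zero hw)),
        S.coverTube j '' lineBox e _, S.coverTube j '' lineBox (beta e) _,
        S.isOpenMap_cover.2 j _ (isOpen_lineBox _ _), S.isOpenMap_cover.2 j _ (isOpen_lineBox _ _),
        ⟨_, hwe, rfl⟩, ⟨_, ?_, rfl⟩, (S.coverProj_zeroSection_eq_iff j hw _).2 (.inr rfl), ?_,
        hinj e he, hinj _ he'⟩
      · change ‖beta w‖ ^ 2 < 2 * ‖inner ℂ (beta e) (beta w)‖ ^ 2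
        rw [norm_inner_beta_left, beta_beta, inner_neg_right, norm_neg,
          LinearIsometryEquiv.norm_map]
        exact hwe
      · rw [disjoint_left]
        rintro _ ⟨q, hq, rfl⟩ ⟨q', hq', h⟩
        exact not_holRel_of_mem_lineBox he hq hq' (S.coverTube_eq_iff.1 h.symm)

open Path in
/-- The loop class of `loop_class` is the image of a path from `y` to `σ y ≠ y`, which is a path
between different points of the double cover; hence it is not trivial. -/
theorem fundamentalGroup_resolution [T2Space Y] (S : DesingData A σ p ζ c t)
    (x : Resolution σ ζ c (fun _ => Kind.X1) t) :
    Nonempty (FundamentalGroup (Resolution σ ζ c (fun _ => Kind.X1) t) x ≃*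
      Multiplicative (ZMod 2)) := by
  have := S.pathConnectedSpace_resolution fun _ => Kind.X1
  have := S.adm.simplyConnected
  obtain ⟨y⟩ : Nonempty ((range p)ᶜ : Set Y) := inferInstance
  let δ : Path y (S.invol y) := (PathConnectedSpace.joined y (S.invol y)).somePath
  refine fundamentalGroup_mulEquiv_zmod_two _ _
    (S.loop_class (fun _ => Kind.X1) y (Homotopic.Quotient.mk δ)) ?_ x
  exact map_ne_refl_of_isCoveringMap (p := ⟨S.coverProj, S.continuous_coverProj⟩)
    S.isCoveringMap_coverProj (fun h => S.invol_ne y (S.coverOuter_injective h).symm)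
    (S.outerMap_invol _ y) (Homotopic.Quotient.mk (δ.map S.continuous_coverOuter))

end DesingData

theorem proposition5p9 {Y : Type*} [TopologicalSpace Y] [T2Space Y] [CompactSpace Y]
    (A : ComplexOrbifold Y) (σ : Y → Y) {k : ℕ} (hk : 1 ≤ k) (p : Fin k → Y)
    (hY : A.Admissible σ p)
    (ζ : ℝ) (hζ : 0 < ζ) (c : Fin k → OrbifoldChart Y)
    (hc : ∀ j, IsResolutionChart A σ (p j) ζ (c j))
    (hdisj : ∀ i j, i ≠ j → Disjoint (chartImage σ ζ (c i)) (chartImage σ ζ (c j)))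
    (n : Fin k → Kind) (t : ℝ) (ht : t ∈ Set.Ioc (0 : ℝ) 1) :
    ((∀ j, n j = Kind.X1) →
      PathConnectedSpace (Resolution σ ζ c n t) ∧
      ∀ x : Resolution σ ζ c n t,
        Nonempty (FundamentalGroup (Resolution σ ζ c n t) x ≃* Multiplicative (ZMod 2))) ∧
    ((∃ j, n j ≠ Kind.X1) → SimplyConnectedSpace (Resolution σ ζ c n t)) := by
  have S : DesingData A σ p ζ c t := ⟨hY, hζ, hc, hdisj, ht⟩
  refine ⟨fun h => ?_, S.simplyConnectedSpace_resolution n⟩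
  obtain rfl : n = fun _ => Kind.X1 := funext h
  exact ⟨S.pathConnectedSpace_resolution _, S.fundamentalGroup_resolution⟩
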